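/- Let $d\ge 0$ be an integer and let $\alpha=(\alpha_1,\dots,\alpha_{d+1})\in\mathbb R^{d+1}$ be strictly increasing. **Trees.** Let $\mathscr T_n$ be the set of unlabeled plane rooted trees with $n+1$ leaves in which every internal (i.e. non-leaf) vertex has at least two children, and let $\mathscr T_{n,n}\subseteq\mathscr T_n$ be the subset of complete binary trees (those with $n$ internal vertices). Let $\mathcal K_d$ be the poset on $\mathscr T_{d+1}\cup\{\hat 0\}$ in which $\hat 0$ is the minimum and $T_1\le T_2$ for $T_1,T_2\in\mathscr T_{d+1}$ if and only if $T_2$ is obtained from $T_1$ by contracting (possibly no) internal edges, i.e. edges joining two internal vertices. Two trees in $\mathscr T_{n,n}$ differ by a *flip* if contracting an internal edge to a left child in one of them and an internal edge to a right child in the other gives the same tree. **Loday associahedron.** For $T\in\mathscr T_{d+1,d+1}$ and $1\le i\le d+1$ let $T_{(i)}$ be the subtree of $T$ rooted at the closest common ancestor of the $i$-th and $(i+1)$-st leaves (from left to right). For a complete binary tree $S$ with $t\ge1$ internal vertices whose left and right subtrees have $a$ and $b$ internal vertices, put $\operatorname{val}(\alpha,S)=\sum_{k=1}^t\alpha_k-\sum_{k=1}^a\alpha_k-\sum_{k=1}^b\alpha_k$.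 Let $v^\alpha_T=(\operatorname{val}(\alpha,T_{(1)}),\dots,\operatorname{val}(\alpha,T_{(d+1)}))$ and $$\mathrm{LodAsso}(\alpha)=\operatorname{ConvexHull}\{v_T^\alpha : T\in\mathscr T_{d+1,d+1}\}\subseteq\mathbb R^{d+1}.$$ **Polytopes.** A face of a polytope $P$ is the empty set or the set of maximizers over $P$ of a linear functional; the face poset of $P$ is the set of its faces ordered by inclusion. A *$d$-associahedron* is a $d$-dimensional polytope with a bijection between its vertices and $\mathscr T_{d+1,d+1}$ such that two distinct vertices form an edge if and only if the corresponding trees differ by a flip. For a polytope $P\subseteq\mathbb R^{d+1}$ on which the sum of the coordinates is constant, the normal cone at a nonempty face $F$ is the set of classes $w\in\mathbb R^{d+1}/\mathbb R(1,\dots,1)$ with $\langle w,y\rangle\ge\langle w,y'\rangle$ for all $y\in F$, $y'\in P$, and the normal fan of $P$ is the set of these cones for all nonempty faces $F$. A *generalized permutohedron* is a polytope $Q\subseteq\mathbb R^{d+1}$ with constant coordinate sum such that, for some strictly increasing $\beta\in\mathbb R^{d+1}$, every cone of the normal fan of $Q$ is a union of cones of the normal fan of the usual permutohedron $\operatorname{ConvexHull}\{(\beta_{\pi(1)},\dots,\beta_{\pi(d+1)})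 : \pi\in\mathfrak S_{d+1}\}$. **Theorem.** The face poset of $\mathrm{LodAsso}(\alpha)$ is isomorphic to $\mathcal K_d$. Moreover, $\mathrm{LodAsso}(\alpha)$ is a $d$-associahedron, and it is a generalized permutohedron. -/

import Mathlib

/-! ## Plane trees -/

/-- Unlabeled plane rooted trees: a tree is the ordered list of the subtrees at its root.
The one-vertex tree is `node []`. -/
inductive PlaneTree : Type
  | node (children : List PlaneTree) : PlaneTree

namespace PlaneTree

/-- Number of leaves (vertices without children). -/
def numLeaves : PlaneTree → ℕ
  | node cs => if cs.isEmpty then 1 else (cs.map numLeaves).sum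

/-- Number of internal vertices (vertices with at least one child). -/
def numInternal : PlaneTree → ℕ
  | node cs => if cs.isEmpty then 0 else 1 + (cs.map numInternal).sum

/-- Every internal vertex has at least two children. -/
inductive StrictlyBranching : PlaneTree → Prop
  | node (cs : List PlaneTree) (hcs : cs = [] ∨ 2 ≤ cs.length)
      (h : ∀ c ∈ cs, StrictlyBranching c) : StrictlyBranching (PlaneTree.node cs)

/-- `ContractsEdge j T S`: the tree `S` is obtained from `T` by contracting one internal edge
whose lower endpoint is the `j`-th child (counting from `0`) of its upper endpoint: the lower
endpoint, which is internal, is replaced by the list of its own children. -/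
inductive ContractsEdge : ℕ → PlaneTree → PlaneTree → Prop
  | root (l c r : List PlaneTree) (hc : c ≠ []) :
      ContractsEdge l.length (node (l ++ node c :: r)) (node (l ++ c ++ r))
  | deeper (j : ℕ) (l r : List PlaneTree) (t s : PlaneTree) (h : ContractsEdge j t s) :
      ContractsEdge j (node (l ++ t :: r)) (node (l ++ s :: r))

/-- `S` is obtained from `T` by contracting a (possibly empty) sequence of internal edges. -/
def ContractsTo : PlaneTree → PlaneTree → Prop :=
  Relation.ReflTransGen fun T S => ∃ j, ContractsEdge j T S

theorem ContractsEdge.numInternal_eq {j : ℕ} {T S : PlaneTree} (h : ContractsEdge j T S) :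
    T.numInternal = S.numInternal + 1 := by
  induction h with
  | root l c r hc =>
    have h1 : (l ++ c ++ r).isEmpty = false := by simp [hc]
    have h2 : c.isEmpty = false := by simp [hc]
    rw [numInternal, numInternal, h1]
    simp only [List.map_append, List.map_cons, List.sum_append, List.sum_cons]
    rw [numInternal, h2]
    simp
    omega
  | deeper j l r t s h ih =>
    rw [numInternal, numInternal]
    simp [ih]
    omega

theorem ContractsTo.eq_or_lt {T S : PlaneTree} (h : ContractsTo T S) :
    T = S ∨ S.numInternal < T.numInternal := by
  induction h with
  | refl => exact Or.inl rfl
  | tail _ hs ih =>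
    obtain ⟨j, hj⟩ := hs
    have := hj.numInternal_eq
    rcases ih with rfl | ih <;> right <;> omega

/-- `T.subtreeAt i` is the subtree of `T` rooted at the closest common ancestor of the leaves number
`i` and `i + 1`, where the leaves are numbered `0, 1, 2, …` from left to right (meaningful for
`i + 1 < T.numLeaves`): descend into the child that contains both leaves as long as there is one.
In `1`-based numbering this is the subtree rooted at the internal vertex with label `i + 1`. -/
def subtreeAt : PlaneTree → ℕ → PlaneTree
  | node cs, i => (go cs i).getD (node cs)
where
  /-- Search the given children from left to right for the one containing both leaves. -/
  go : List PlaneTree → ℕ → Option PlaneTree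
    | [], _ => none
    | c :: cs, i =>
      if c.numLeaves ≤ i then go cs (i - c.numLeaves)
      else if i + 1 < c.numLeaves then some (c.subtreeAt i)
      else none

end PlaneTree

/-- Strictly branching plane trees with `n + 1` leaves. -/
def SBTree (n : ℕ) : Type :=
  {T : PlaneTree // T.StrictlyBranching ∧ T.numLeaves = n + 1}

/-- `T₁ ≤ T₂` when `T₂` is obtained from `T₁` by contracting internal edges. -/
instance (n : ℕ) : PartialOrder (SBTree n) where
  le T₁ T₂ := T₁.1.ContractsTo T₂.1
  le_refl _ := Relation.ReflTransGen.refl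
  le_trans _ _ _ h₁ h₂ := Relation.ReflTransGen.trans h₁ h₂
  le_antisymm T₁ T₂ h₁ h₂ := by
    rcases PlaneTree.ContractsTo.eq_or_lt h₁ with h | h
    · exact Subtype.ext h
    · rcases PlaneTree.ContractsTo.eq_or_lt h₂ with h' | h'
      · exact Subtype.ext h'.symm
      · omega

/-- The poset `𝒦_d`: strictly branching plane trees with `d + 2` leaves, ordered by contraction of
internal edges, together with an extra minimum. -/
abbrev AssoPoset (d : ℕ) : Type := WithBot (SBTree (d + 1))

/-- Complete binary trees with `n + 1` leaves, that is, the strictly branching plane trees with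
`n + 1` leaves and `n` internal vertices. -/
def CBTree (n : ℕ) : Type := {T : SBTree n // T.1.numInternal = n}

/-- `T` and `T'` differ by a flip: contracting a Left internal edge in one of them and a Right
internal edge in the other one gives the same tree. -/
def CBTree.Flip {n : ℕ} (T T' : CBTree n) : Prop :=
  ∃ S : PlaneTree,
    (PlaneTree.ContractsEdge 0 T.1.1 S ∧ PlaneTree.ContractsEdge 1 T'.1.1 S) ∨
    (PlaneTree.ContractsEdge 1 T.1.1 S ∧ PlaneTree.ContractsEdge 0 T'.1.1 S)

/-! ## The Loday associahedron -/

/-- `α₁ + ⋯ + α_t`, the sum of the first `t` entries of `α`. -/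
noncomputable def initialSum {n : ℕ} (α : Fin n → ℝ) (t : ℕ) : ℝ :=
  ∑ k : Fin n with k.val < t, α k

/-- `val(α, T)` for a complete binary tree `T` with at least one internal vertex; the value is
irrelevant on other trees. -/
noncomputable def treeVal {n : ℕ} (α : Fin n → ℝ) : PlaneTree → ℝ
  | .node [L, R] =>
      initialSum α (PlaneTree.node [L, R]).numInternal
        - initialSum α L.numInternal - initialSum α R.numInternal
  | _ => 0

/-- The point `v_T^α`. -/
noncomputable def lodayVertex {n : ℕ} (α : Fin n → ℝ) (T : CBTree n) : Fin n → ℝ :=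
  fun i => treeVal α (T.1.1.subtreeAt i.val)

/-- The Loday associahedron of `α`. -/
def LodAsso {n : ℕ} (α : Fin n → ℝ) : Set (Fin n → ℝ) :=
  convexHull ℝ (Set.range (lodayVertex α))

/-! ## Polytopes, faces, normal fans -/

/-- A polytope in `ℝⁿ`. -/
def IsPolytope {n : ℕ} (P : Set (Fin n → ℝ)) : Prop :=
  ∃ s : Set (Fin n → ℝ), s.Finite ∧ P = convexHull ℝ s

/-- The face poset: all faces of `P`, ordered by inclusion. `IsExposed ℝ P F` says that `F` is empty
or the set of maximizers over `P` of some linear functional. -/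
abbrev FacePoset {n : ℕ} (P : Set (Fin n → ℝ)) : Type :=
  {F : Set (Fin n → ℝ) // IsExposed ℝ P F}

/-- A `d`-associahedron: a `d`-dimensional polytope whose vertices are in bijection with the complete
binary trees with `d + 2` leaves, in such a way that two (different) vertices span an edge if and
only if the corresponding trees differ by a flip. -/
def IsAssociahedron {n : ℕ} (d : ℕ) (P : Set (Fin n → ℝ)) : Prop :=
  IsPolytope P ∧ Module.finrank ℝ (vectorSpan ℝ P) = d ∧
    ∃ e : CBTree (d + 1) ≃ P.exposedPoints ℝ, ∀ T T' : CBTree (d + 1), T ≠ T' →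
      (IsExposed ℝ P (segment ℝ (e T : Fin n → ℝ) (e T')) ↔ T.Flip T')

/-- The quotient of `ℝⁿ` by the line spanned by `(1, …, 1)`. Through the dot product it is the dual of
the space of vectors with coordinate sum `0`. -/
abbrev OneQuotient (n : ℕ) : Type :=
  (Fin n → ℝ) ⧸ Submodule.span ℝ {(1 : Fin n → ℝ)}

/-- The normal cone of `P` at `F`, for `F ⊆ P` where the coordinate sum is constant on `P`: the classes
of all `w` whose dot product with points of `P` is maximal at all points of `F`. (The condition then
depends only on the class of `w`.) -/
def normalCone {n : ℕ} (F P : Set (Fin n → ℝ)) : Set (OneQuotient n) :=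
  (Submodule.span ℝ {(1 : Fin n → ℝ)}).mkQ ''
    {w | ∀ y ∈ F, ∀ y' ∈ P, w ⬝ᵥ y' ≤ w ⬝ᵥ y}

/-- The normal fan: the normal cones at all nonempty faces. -/
def normalFan {n : ℕ} (P : Set (Fin n → ℝ)) : Set (Set (OneQuotient n)) :=
  {C | ∃ F : Set (Fin n → ℝ), IsExposed ℝ P F ∧ F.Nonempty ∧ C = normalCone F P}

/-- `Q` is a deformation of `P`: every cone in the normal fan of `Q` is a union of cones in the normal
fan of `P`. -/
def IsDeformation {n : ℕ} (Q P : Set (Fin n → ℝ)) : Prop :=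
  ∀ C ∈ normalFan Q, ∃ 𝒮 ⊆ normalFan P, C = ⋃₀ 𝒮

/-- The usual permutohedron of `β`. -/
def Permutohedron {n : ℕ} (β : Fin n → ℝ) : Set (Fin n → ℝ) :=
  convexHull ℝ (Set.range fun π : Equiv.Perm (Fin n) => fun i => β (π i))

/-- A generalized permutohedron: a polytope in a translate of the space of vectors with coordinate sum
`0` that is a deformation of some usual permutohedron. -/
def IsGeneralizedPermutohedron {n : ℕ} (Q : Set (Fin n → ℝ)) : Prop :=
  IsPolytope Q ∧ (∃ c : ℝ, ∀ x ∈ Q, ∑ i, x i = c) ∧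
    ∃ β : Fin n → ℝ, StrictMono β ∧ IsDeformation Q (Permutohedron β)

/-! Number leaves and coordinates from `0`, so that coordinate `i` is the gap between leaves `i` and
`i + 1`, and record an internal vertex by its bracket: the interval of leaves `a, …, b` below it,
which spans the coordinates in `[a, b)`. The proof rests on three facts.

Contraction is reverse inclusion of bracket sets (`SBTree.le_iff`), so the combinatorics of trees
becomes that of sets of intervals.

On the Loday polytope the sum of the coordinates in `[a, b)` is at least the sum of the first `b -
a` entries of `α`, and at the vertex of a binary tree equality holds exactly when `[a, b)` is a
bracket (`sum_treeVal_subtreeAt`, `intervalSum_lodayVertex`). The vertex value at the root is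
monotone in the sizes of both subtrees because `α` is increasing.

A linear functional `w` defines a tree: cut an interval at its positions of largest weight and
recurse. Abel summation along this recursion writes `w ⬝ᵥ z` as a multiple of the total sum of `z`
minus a positive combination of the bracket sums (`sum_weight_le`). Hence `w` is maximal exactly
where all bracket inequalities of its tree are equalities (`treeFace_eq_maximizers`). Every strictly
branching tree arises from some `w`, so the nonempty faces are the sets `treeFace α T`. Breaking
ties in `w` yields binary refinements of `T` that avoid any prescribed non-bracket, which makes `T ↦
treeFace α T` an order embedding.

Vertices and edges are then read off from the binary trees below a given tree. A functional constant
on the polytope has the total interval as its only bracket, hence equal coordinates; this gives the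
dimension. Finally, the tree of `w` depends only on the weak order of the entries of `w`, which is
the datum recorded by the normal fan of the permutohedron. -/

namespace PlaneTree

/-! ### Forests -/

/-- Trees are a nested inductive type. Peeling off the first tree as its list of children and the
remaining forest turns the mutual recursor into a single induction on forests. -/
theorem forest_induction {P : List PlaneTree → Prop} (nil : P [])
    (cons : ∀ cs ds, P cs → P ds → P (node cs :: ds)) (F : List PlaneTree) : P F :=
  PlaneTree.rec_1 (motive_1 := fun t => ∀ ds, P ds → P (t :: ds)) (motive_2 := P)
    (fun cs h ds hd => cons cs ds h hd) nil (fun _ ts h1 h2 => h1 ts h2) F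

/-- Total number of leaves of a forest. -/
def leaves (F : List PlaneTree) : ℕ := (F.map numLeaves).sum

@[simp] theorem leaves_nil : leaves [] = 0 := rfl

@[simp] theorem leaves_cons (t : PlaneTree) (F : List PlaneTree) :
    leaves (t :: F) = t.numLeaves + leaves F := by simp [leaves]

@[simp] theorem leaves_append (F G : List PlaneTree) :
    leaves (F ++ G) = leaves F + leaves G := by simp [leaves]

@[simp] theorem numLeaves_leaf : (node []).numLeaves = 1 := by rw [numLeaves]; simp

theorem numLeaves_node {cs : List PlaneTree} (h : cs ≠ []) :
    (node cs).numLeaves = leaves cs := by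
  rw [numLeaves]; simp [h, leaves]

theorem numLeaves_pos (t : PlaneTree) : 1 ≤ t.numLeaves := by
  have key : ∀ F : List PlaneTree, F.length ≤ leaves F := by
    intro F
    induction F using forest_induction with
    | nil => simp
    | cons cs ds h1 h2 =>
      by_cases hc : cs = []
      · subst hc; simp; omega
      · have := List.length_pos_iff.mpr hc
        simp [numLeaves_node hc]; omega
  simpa using key [t]

theorem length_le_leaves (F : List PlaneTree) : F.length ≤ leaves F := by
  induction F with
  | nil => simp
  | cons t F ih => have := numLeaves_pos t; simp; omega

theorem strictlyBranching_node_iff {cs : List PlaneTree} :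
    (node cs).StrictlyBranching ↔
      (cs = [] ∨ 2 ≤ cs.length) ∧ ∀ c ∈ cs, c.StrictlyBranching := by
  constructor
  · rintro ⟨_, h1, h2⟩; exact ⟨h1, h2⟩
  · rintro ⟨h1, h2⟩; exact ⟨_, h1, h2⟩

/-! ### Brackets -/

/-- `IsBracket F o a b`: when the leaves of the forest `F` are numbered from left to right starting
with `o`, some internal vertex of `F` has exactly the leaves `a, …, b` below it. -/
def IsBracket : List PlaneTree → ℕ → ℕ → ℕ → Prop
  | [], _, _, _ => False
  | node cs :: ds, o, a, b =>
    (cs ≠ [] ∧ a = o ∧ b + 1 = o + leaves cs) ∨ IsBracket cs o a b ∨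
      IsBracket ds (o + (node cs).numLeaves) a b
termination_by F => sizeOf F
decreasing_by all_goals simp_wf <;> omega

@[simp] theorem isBracket_nil (o a b : ℕ) : IsBracket [] o a b ↔ False := by rw [IsBracket]

theorem isBracket_cons_node (cs ds : List PlaneTree) (o a b : ℕ) :
    IsBracket (node cs :: ds) o a b ↔
      (cs ≠ [] ∧ a = o ∧ b + 1 = o + leaves cs) ∨ IsBracket cs o a b ∨
        IsBracket ds (o + (node cs).numLeaves) a b := by rw [IsBracket]

theorem isBracket_singleton (cs : List PlaneTree) (o a b : ℕ) :
    IsBracket [node cs] o a b ↔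
      (cs ≠ [] ∧ a = o ∧ b + 1 = o + leaves cs) ∨ IsBracket cs o a b := by
  simp [isBracket_cons_node]

theorem isBracket_cons (t : PlaneTree) (ds : List PlaneTree) (o a b : ℕ) :
    IsBracket (t :: ds) o a b ↔ IsBracket [t] o a b ∨ IsBracket ds (o + t.numLeaves) a b := by
  obtain ⟨cs⟩ := t
  rw [isBracket_cons_node, isBracket_singleton, or_assoc]

theorem isBracket_append (F G : List PlaneTree) (o a b : ℕ) :
    IsBracket (F ++ G) o a b ↔ IsBracket F o a b ∨ IsBracket G (o + leaves F) a b := by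
  induction F generalizing o with
  | nil => simp
  | cons t F ih =>
    rw [List.cons_append, isBracket_cons, ih, isBracket_cons t F, or_assoc]
    simp [add_assoc]

theorem IsBracket.bounds {F : List PlaneTree} {o a b : ℕ} (h : IsBracket F o a b)
    (hF : ∀ t ∈ F, t.StrictlyBranching) : o ≤ a ∧ a < b ∧ b + 1 ≤ o + leaves F := by
  induction F using forest_induction generalizing o with
  | nil => simp at h
  | cons cs ds h1 h2 =>
    simp only [List.mem_cons, forall_eq_or_imp, strictlyBranching_node_iff] at hF
    obtain ⟨⟨hl, hcs⟩, hds⟩ := hF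
    rw [isBracket_cons_node] at h
    have hlen := length_le_leaves cs
    rcases h with ⟨hne, rfl, hb⟩ | h | h
    · rcases hl with hl | hl
      · exact absurd hl hne
      · simp [numLeaves_node hne]; omega
    · have hne : cs ≠ [] := by rintro rfl; simp at h
      have := h1 h hcs
      simp [numLeaves_node hne]; omega
    · have := h2 h hds
      simp; omega

/-- Since there are at least two children, no single child sees all the leaves. Thus the bracket of
a vertex is never repeated below it. -/
theorem IsBracket.lt_of_children {cs : List PlaneTree} {o a b : ℕ} (h : IsBracket cs o a b)
    (hS : (node cs).StrictlyBranching) : ¬ (a = o ∧ b + 1 = o + leaves cs) := by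
  rintro ⟨rfl, hb⟩
  obtain ⟨hl, hcs⟩ := strictlyBranching_node_iff.mp hS
  match cs, hl with
  | t :: t' :: r, _ =>
    rw [isBracket_cons] at h
    have h1 := numLeaves_pos t
    have h2 := numLeaves_pos t'
    simp only [leaves_cons] at hb
    rcases h with h | h
    · have := h.bounds (by simp_all)
      simp at this; omega
    · have := h.bounds (fun x hx => hcs x (List.mem_cons_of_mem _ hx))
      omega
  | [], _ => simp at h

/-! ### Contractions and brackets -/

theorem ContractsEdge.leaves_and_brackets {j : ℕ} {T S : PlaneTree} (h : ContractsEdge j T S) :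
    T.numLeaves = S.numLeaves ∧ ∀ o a b, IsBracket [S] o a b → IsBracket [T] o a b := by
  induction h with
  | root l c r hc =>
    have h1 : l ++ c ++ r ≠ [] := by simp [hc]
    have h2 : l ++ node c :: r ≠ [] := by simp
    refine ⟨by rw [numLeaves_node h1, numLeaves_node h2]; simp [numLeaves_node hc], ?_⟩
    intro o a b h
    rw [isBracket_singleton, isBracket_append, isBracket_append] at h
    rw [isBracket_singleton, isBracket_append, isBracket_cons_node, numLeaves_node hc]
    simp only [leaves_append, leaves_cons, numLeaves_node hc, ← add_assoc] at h ⊢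
    tauto
  | deeper j l r t s _ ih =>
    have h1 : l ++ t :: r ≠ [] := by simp
    have h2 : l ++ s :: r ≠ [] := by simp
    refine ⟨by rw [numLeaves_node h1, numLeaves_node h2]; simp [ih.1], ?_⟩
    intro o a b h
    rw [isBracket_singleton, isBracket_append, isBracket_cons] at h
    rw [isBracket_singleton, isBracket_append, isBracket_cons]
    simp only [leaves_append, leaves_cons, ih.1] at h ⊢
    have := ih.2 (o + leaves l) a b
    tauto

theorem ContractsEdge.strictlyBranching {j : ℕ} {T S : PlaneTree} (h : ContractsEdge j T S)
    (hT : T.StrictlyBranching) : S.StrictlyBranching := by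
  induction h with
  | root l c r hc =>
    rw [strictlyBranching_node_iff] at hT ⊢
    obtain ⟨h1, h2⟩ := hT
    have h3 := strictlyBranching_node_iff.mp (h2 (node c) (by simp))
    refine ⟨Or.inr ?_, ?_⟩
    · have := h3.1.resolve_left hc
      simp; omega
    · intro x hx
      simp only [List.mem_append] at hx
      rcases hx with (hx | hx) | hx
      · exact h2 x (by simp [hx])
      · exact h3.2 x hx
      · exact h2 x (by simp [hx])
  | deeper j l r t s _ ih =>
    rw [strictlyBranching_node_iff] at hT ⊢
    obtain ⟨h1, h2⟩ := hT
    refine ⟨by simpa using h1, ?_⟩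
    intro x hx
    simp only [List.mem_append, List.mem_cons] at hx
    rcases hx with hx | rfl | hx
    · exact h2 x (by simp [hx])
    · exact ih (h2 t (by simp))
    · exact h2 x (by simp [hx])

theorem ContractsTo.isBracket {T S : PlaneTree} (h : ContractsTo T S) {o a b : ℕ}
    (hS : IsBracket [S] o a b) : IsBracket [T] o a b := by
  induction h with
  | refl => exact hS
  | tail _ hs ih =>
    obtain ⟨j, hj⟩ := hs
    exact ih (hj.leaves_and_brackets.2 _ _ _ hS)

theorem ContractsTo.deeper {t s : PlaneTree} (l r : List PlaneTree) (h : ContractsTo t s) :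
    ContractsTo (node (l ++ t :: r)) (node (l ++ s :: r)) := by
  induction h with
  | refl => exact Relation.ReflTransGen.refl
  | tail _ hs ih =>
    obtain ⟨j, hj⟩ := hs
    exact Relation.ReflTransGen.tail ih ⟨j, .deeper j l r _ _ hj⟩

theorem ContractsEdge.append_left {j : ℕ} {F G : List PlaneTree} (l : List PlaneTree)
    (h : ContractsEdge j (node F) (node G)) :
    ∃ j, ContractsEdge j (node (l ++ F)) (node (l ++ G)) := by
  generalize hT : node F = T at h
  generalize hS : node G = S at h
  cases h with
  | root l' c r hc =>
    simp only [node.injEq] at hT hS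
    subst hT hS
    exact ⟨(l ++ l').length, by simpa using ContractsEdge.root (l ++ l') c r hc⟩
  | deeper _ l' r t s h =>
    simp only [node.injEq] at hT hS
    subst hT hS
    exact ⟨j, by simpa using ContractsEdge.deeper j (l ++ l') r _ _ h⟩

theorem ContractsTo.append_left {F G : List PlaneTree} (l : List PlaneTree)
    (h : ContractsTo (node F) (node G)) : ContractsTo (node (l ++ F)) (node (l ++ G)) := by
  generalize hS : node G = S at h
  induction h generalizing G with
  | refl =>
    simp only [node.injEq] at hS
    subst hS
    exact Relation.ReflTransGen.refl
  | @tail b _ _ hs ih =>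
    obtain ⟨B⟩ := b
    subst hS
    obtain ⟨j, hj⟩ := hs
    exact Relation.ReflTransGen.tail (ih rfl) (hj.append_left l)

/-- A forest whose brackets contain those of another forest with the same number of leaves
contracts to it (below a common root). -/
theorem contractsTo_of_forest_isBracket (N : ℕ) : ∀ F G : List PlaneTree,
    sizeOf F + sizeOf G ≤ N →
    (∀ t ∈ F, t.StrictlyBranching) → (∀ t ∈ G, t.StrictlyBranching) → leaves F = leaves G →
    ∀ o, (∀ a b, IsBracket G o a b → IsBracket F o a b) → ContractsTo (node F) (node G) := by
  induction N with
  | zero =>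
    intro F G h
    have : 0 < sizeOf F := by cases F <;> simp
    omega
  | succ N ih =>
    intro F G hN hF hG hl o hB
    match F, G with
    | [], [] => exact Relation.ReflTransGen.refl
    | [], t :: G => have := numLeaves_pos t; simp at hl; omega
    | t :: F, [] => have := numLeaves_pos t; simp at hl; omega
    | node as :: bs, node cs :: ds =>
      simp only [List.mem_cons, forall_eq_or_imp] at hF hG
      obtain ⟨hA, hbs⟩ := hF
      obtain ⟨hC, hds⟩ := hG
      have hA' := strictlyBranching_node_iff.mp hA
      have hC' := strictlyBranching_node_iff.mp hC
      simp only [leaves_cons] at hl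
      -- If the bracket of the first tree of `F` is absent from `G`, its root edge can be
      -- contracted: only that bracket is lost, so the hypothesis survives.
      have contract : as ≠ [] → ¬ IsBracket (node cs :: ds) o o (o + leaves as - 1) →
          ContractsTo (node (node as :: bs)) (node (node cs :: ds)) := by
        intro hne hn
        refine Relation.ReflTransGen.head ⟨_, ContractsEdge.root [] as bs hne⟩ ?_
        have hpos := length_le_leaves as
        have := List.length_pos_iff.mpr hne
        refine ih (as ++ bs) _ ?_ ?_ ?_ ?_ o ?_
        · have : sizeOf (as ++ bs) ≤ sizeOf as + sizeOf bs := by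
            clear * -
            induction as with
            | nil => simp
            | cons a as ih => simp; omega
          simp at hN ⊢; omega
        · intro t ht
          rcases List.mem_append.mp ht with h | h
          · exact hA'.2 t h
          · exact hbs t h
        · simpa using ⟨hC, hds⟩
        · simpa [numLeaves_node hne] using hl
        · intro a b h
          have h' := hB a b h
          rw [isBracket_cons_node, numLeaves_node hne] at h'
          rw [isBracket_append]
          rcases h' with ⟨-, rfl, hb⟩ | h' | h'
          · exfalso; apply hn
            convert h using 1
            omega
          · exact Or.inl h'
          · exact Or.inr h'
      -- If the first trees cover the same leaves, the two forests can be compared tree by tree: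
      -- brackets of `ds` lie too far right to come from `node as`.
      have tail : (node as).numLeaves = (node cs).numLeaves →
          ContractsTo (node as) (node cs) →
          ContractsTo (node (node as :: bs)) (node (node cs :: ds)) := by
        intro hk h1
        refine Relation.ReflTransGen.trans (ContractsTo.deeper [] bs h1) ?_
        refine ContractsTo.append_left [node cs] ?_
        refine ih bs ds (by simp at hN; omega) hbs hds (by omega)
          (o + (node cs).numLeaves) ?_
        intro a b h
        have h2 := hB a b (by rw [isBracket_cons]; exact Or.inr h)
        rw [isBracket_cons] at h2
        rcases h2 with h2 | h2
        · have b1 := h2.bounds (by simpa using hA)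
          have b2 := h.bounds hds
          simp at b1; omega
        · rwa [hk] at h2
      by_cases hcs : cs = []
      · subst hcs
        by_cases has : as = []
        · subst has
          exact tail rfl Relation.ReflTransGen.refl
        · refine contract has ?_
          rw [isBracket_cons]
          rintro (h | h)
          · simp [isBracket_singleton] at h
          · have := h.bounds hds
            have := numLeaves_pos (node [])
            omega
      · have hroot := hB o (o + leaves cs - 1) (by
          rw [isBracket_cons_node]
          have := length_le_leaves cs
          have := List.length_pos_iff.mpr hcs
          exact Or.inl ⟨hcs, rfl, by omega⟩)
        have hcl := length_le_leaves cs
        have hcl2 := hC'.1.resolve_left hcs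
        rw [isBracket_cons] at hroot
        have hroot := hroot.resolve_right (fun h => by
          have := h.bounds hbs
          have := numLeaves_pos (node as)
          omega)
        have hbd := hroot.bounds (by simpa using hA)
        have has : as ≠ [] := by
          rintro rfl; simp [isBracket_singleton] at hroot
        simp only [leaves_cons, leaves_nil, numLeaves_node has] at hbd
        by_cases hk : leaves as = leaves cs
        · refine tail (by rw [numLeaves_node has, numLeaves_node hcs, hk]) ?_
          refine ih as cs (by simp at hN; omega) hA'.2 hC'.2 hk o ?_
          intro a b h
          have h2 := hB a b (by rw [isBracket_cons_node]; exact Or.inr (Or.inl h))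
          have h3 := h.lt_of_children hC
          have h4 := h.bounds hC'.2
          rw [isBracket_cons_node] at h2
          rcases h2 with h2 | h2 | h2
          · rw [hk] at h2; exact absurd h2.2 h3
          · exact h2
          · have h5 := h2.bounds hbs
            rw [numLeaves_node has] at h5
            omega
        -- Here the first tree of `F` has more leaves than that of `G`, so its bracket straddles two
        -- trees of `G`.
        · refine contract has ?_
          rw [isBracket_cons]
          rintro (h | h)
          · have := h.bounds (by simpa using hC)
            simp [numLeaves_node hcs] at this; omega
          · have := h.bounds hds
            have := numLeaves_pos (node cs)
            omega

/-- With at least two leaves both roots are internal and have the same bracket, which no vertex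
below repeats; removing the roots reduces to forests. -/
theorem contractsTo_of_isBracket {T S : PlaneTree} (hT : T.StrictlyBranching)
    (hS : S.StrictlyBranching) (hl : T.numLeaves = S.numLeaves) (h2 : 2 ≤ T.numLeaves)
    (h : ∀ a b, IsBracket [S] 0 a b → IsBracket [T] 0 a b) : ContractsTo T S := by
  obtain ⟨as⟩ := T
  obtain ⟨cs⟩ := S
  have has : as ≠ [] := by rintro rfl; simp at h2
  have hcs : cs ≠ [] := by rintro rfl; simp at hl; omega
  rw [numLeaves_node has, numLeaves_node hcs] at hl
  refine contractsTo_of_forest_isBracket _ as cs le_rfl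
    (strictlyBranching_node_iff.mp hT).2 (strictlyBranching_node_iff.mp hS).2 hl 0 ?_
  intro a b hb
  have h3 := h a b (by rw [isBracket_singleton]; exact Or.inr hb)
  rw [isBracket_singleton, hl] at h3
  exact h3.resolve_left fun h4 => hb.lt_of_children hS h4.2

end PlaneTree

namespace PlaneTree

/-! ### Complete binary trees -/

/-- Complete binary trees: every internal vertex has exactly two children. -/
inductive IsBinary : PlaneTree → Prop
  | leaf : IsBinary (node [])
  | node (L R : PlaneTree) (hL : IsBinary L) (hR : IsBinary R) : IsBinary (node [L, R])

theorem numLeaves_pair (L R : PlaneTree) :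
    (node [L, R]).numLeaves = L.numLeaves + R.numLeaves := by
  rw [numLeaves_node (by simp)]; simp

theorem numInternal_pair (L R : PlaneTree) :
    (node [L, R]).numInternal = 1 + (L.numInternal + R.numInternal) := by
  rw [numInternal]; simp

theorem IsBinary.strictlyBranching {T : PlaneTree} (h : T.IsBinary) : T.StrictlyBranching := by
  induction h with
  | leaf => exact strictlyBranching_node_iff.mpr (by simp)
  | node L R _ _ h1 h2 => exact strictlyBranching_node_iff.mpr (by simp [h1, h2])

theorem IsBinary.numInternal_add_one {T : PlaneTree} (h : T.IsBinary) :
    T.numInternal + 1 = T.numLeaves := by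
  induction h with
  | leaf => rw [numInternal]; simp
  | node L R _ _ h1 h2 => rw [numLeaves_pair, numInternal_pair]; omega

theorem isBinary_of_numInternal {T : PlaneTree} (h : T.StrictlyBranching)
    (hT : T.numInternal + 1 = T.numLeaves) : T.IsBinary := by
  -- Each internal vertex merges at least two trees into one, so internal vertices plus trees never
  -- exceed leaves, and equality forces every merge to be binary.
  have key : ∀ F : List PlaneTree, (∀ t ∈ F, t.StrictlyBranching) →
      (F.map numInternal).sum + F.length ≤ leaves F ∧
      ((F.map numInternal).sum + F.length = leaves F → ∀ t ∈ F, t.IsBinary) := by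
    intro F
    induction F using forest_induction with
    | nil => simp
    | cons cs ds h1 h2 =>
      intro hF
      simp only [List.mem_cons, forall_eq_or_imp, strictlyBranching_node_iff] at hF
      obtain ⟨⟨hl, hcs⟩, hds⟩ := hF
      have h2 := h2 hds
      by_cases hc : cs = []
      · subst hc
        have h0 : (node []).numInternal = 0 := by rw [numInternal]; simp
        simp only [List.map_cons, List.sum_cons, h0, List.length_cons, leaves_cons,
          numLeaves_leaf, List.mem_cons, forall_eq_or_imp]
        refine ⟨by omega, fun h => ⟨.leaf, h2.2 (by omega)⟩⟩
      · have h1 := h1 hcs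
        have hl := hl.resolve_left hc
        have h0 : (node cs).numInternal = 1 + (cs.map numInternal).sum := by
          rw [numInternal]; simp [hc]
        simp only [List.map_cons, List.sum_cons, h0, List.length_cons, leaves_cons,
          numLeaves_node hc, List.mem_cons, forall_eq_or_imp]
        refine ⟨by omega, fun h => ⟨?_, h2.2 (by omega)⟩⟩
        have hlen : cs.length = 2 := by omega
        have hb := h1.2 (by omega)
        obtain ⟨L, R, rfl⟩ := List.length_eq_two.mp hlen
        exact .node _ _ (hb L (by simp)) (hb R (by simp))
  exact (key [T] (by simpa using h)).2 (by simpa using hT) T (by simp)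

/-! ### Flips -/

/-- The possible shapes of an edge contraction in a complete binary tree. -/
theorem ContractsEdge.cases_of_isBinary {k : ℕ} {U S : PlaneTree} (h : ContractsEdge k U S)
    (hU : U.IsBinary) :
    (∃ A B C, A.IsBinary ∧ B.IsBinary ∧ C.IsBinary ∧ S = PlaneTree.node [A, B, C] ∧
      (k = 0 ∧ U = PlaneTree.node [PlaneTree.node [A, B], C] ∨
        k = 1 ∧ U = PlaneTree.node [A, PlaneTree.node [B, C]])) ∨
    (∃ u s b, u.IsBinary ∧ b.IsBinary ∧ ContractsEdge k u s ∧
      (U = PlaneTree.node [u, b] ∧ S = PlaneTree.node [s, b] ∨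
        U = PlaneTree.node [b, u] ∧ S = PlaneTree.node [b, s])) := by
  have split : ∀ {l r : List PlaneTree} {t : PlaneTree},
      (PlaneTree.node (l ++ t :: r)).IsBinary →
      (∃ b, l = [] ∧ r = [b] ∧ t.IsBinary ∧ b.IsBinary) ∨
      (∃ b, l = [b] ∧ r = [] ∧ t.IsBinary ∧ b.IsBinary) := by
    intro l r t h
    generalize hx : l ++ t :: r = x at h
    cases h with
    | leaf => simp at hx
    | node L R hL hR =>
      match l, hx with
      | [], hx =>
        simp at hx
        obtain ⟨rfl, rfl⟩ := hx
        exact Or.inl ⟨R, rfl, rfl, hL, hR⟩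
      | [a], hx =>
        simp at hx
        obtain ⟨rfl, rfl, rfl⟩ := hx
        exact Or.inr ⟨a, rfl, rfl, hR, hL⟩
      | a :: a' :: l, hx => simp at hx
  cases h with
  | root l c r hc =>
    left
    rcases split hU with ⟨b, rfl, rfl, ht, hb⟩ | ⟨b, rfl, rfl, ht, hb⟩
    · cases ht with
      | leaf => simp at hc
      | node A B hA hB => exact ⟨A, B, b, hA, hB, hb, by simp, Or.inl (by simp)⟩
    · cases ht with
      | leaf => simp at hc
      | node A B hA hB => exact ⟨b, A, B, hb, hA, hB, by simp, Or.inr (by simp)⟩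
  | deeper _ l r t s h =>
    right
    rcases split hU with ⟨b, rfl, rfl, ht, hb⟩ | ⟨b, rfl, rfl, ht, hb⟩
    · exact ⟨t, s, b, ht, hb, h, Or.inl (by simp)⟩
    · exact ⟨t, s, b, ht, hb, h, Or.inr (by simp)⟩

/-- The two complete binary trees that contract to the result of contracting one edge of a complete
binary tree. -/
theorem ContractsEdge.exists_flip {T : PlaneTree} (hT : T.IsBinary) :
    ∀ {j : ℕ} {S : PlaneTree}, ContractsEdge j T S →
      ∃ T', T'.IsBinary ∧ T' ≠ T ∧
        (ContractsEdge 0 T S ∧ ContractsEdge 1 T' S ∨ ContractsEdge 1 T S ∧ ContractsEdge 0 T' S) ∧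
        ∀ k U, U.IsBinary → ContractsEdge k U S → U = T ∨ U = T' := by
  -- A contraction keeps the leaves and loses an internal vertex, while binary trees with equally
  -- many leaves have equally many internal vertices.
  have not_edge : ∀ {k : ℕ} {u s : PlaneTree}, u.IsBinary → s.IsBinary → ¬ ContractsEdge k u s := by
    intro k u s hu hs h
    have h1 := h.numInternal_eq
    have h2 := h.leaves_and_brackets.1
    have := hu.numInternal_add_one
    have := hs.numInternal_add_one
    omega
  have edge0 : ∀ A B C, ContractsEdge 0 (PlaneTree.node [PlaneTree.node [A, B], C])
      (PlaneTree.node [A, B, C]) := fun A B C => .root [] [A, B] [C] (by simp)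
  have edge1 : ∀ A B C, ContractsEdge 1 (PlaneTree.node [A, PlaneTree.node [B, C]])
      (PlaneTree.node [A, B, C]) := fun A B C => .root [A] [B, C] [] (by simp)
  have deepL : ∀ {k u s} b, ContractsEdge k u s →
      ContractsEdge k (PlaneTree.node [u, b]) (PlaneTree.node [s, b]) :=
    fun b h => .deeper _ [] [b] _ _ h
  have deepR : ∀ {k u s} b, ContractsEdge k u s →
      ContractsEdge k (PlaneTree.node [b, u]) (PlaneTree.node [b, s]) :=
    fun b h => .deeper _ [b] [] _ _ h
  have ne : ∀ A B C : PlaneTree, PlaneTree.node [PlaneTree.node [A, B], C] ≠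
      PlaneTree.node [A, PlaneTree.node [B, C]] := by
    intro A B C h
    have := congrArg sizeOf (List.cons.inj (PlaneTree.node.inj h)).1
    simp at this; omega
  induction hT with
  | leaf =>
    intro j S h
    rcases h.cases_of_isBinary .leaf with ⟨A, B, C, -, -, -, -, h⟩ | ⟨u, s, b, -, -, -, h⟩ <;>
      simp at h
  | node L R hL hR ihL ihR =>
    intro j S h
    rcases h.cases_of_isBinary (.node _ _ hL hR) with
      ⟨A, B, C, hA, hB, hC, rfl, h'⟩ | ⟨u, s, b, hu, hb, hus, h'⟩
    · have key : ∀ k U, U.IsBinary → ContractsEdge k U (PlaneTree.node [A, B, C]) →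
          U = PlaneTree.node [PlaneTree.node [A, B], C] ∨
          U = PlaneTree.node [A, PlaneTree.node [B, C]] := by
        intro k U hU h
        rcases h.cases_of_isBinary hU with ⟨A', B', C', -, -, -, h1, h2⟩ | ⟨u, s, b, -, -, -, h1⟩
        · simp only [PlaneTree.node.injEq, List.cons.injEq, and_true] at h1
          obtain ⟨rfl, rfl, rfl⟩ := h1
          rcases h2 with h2 | h2
          · exact Or.inl h2.2
          · exact Or.inr h2.2
        · simp at h1
      rcases h' with ⟨-, h'⟩ | ⟨-, h'⟩
      · rw [h']
        exact ⟨PlaneTree.node [A, PlaneTree.node [B, C]], .node _ _ hA (.node _ _ hB hC),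
          (ne A B C).symm, Or.inl ⟨edge0 _ _ _, edge1 _ _ _⟩, key⟩
      · rw [h']
        exact ⟨PlaneTree.node [PlaneTree.node [A, B], C], .node _ _ (.node _ _ hA hB) hC,
          ne A B C, Or.inr ⟨edge1 _ _ _, edge0 _ _ _⟩, fun k U h1 h2 => (key k U h1 h2).symm⟩
    · rcases h' with ⟨h1, rfl⟩ | ⟨h1, rfl⟩
      · simp only [PlaneTree.node.injEq, List.cons.injEq, and_true] at h1
        obtain ⟨rfl, rfl⟩ := h1
        obtain ⟨T', hT', hne, hfl, huniq⟩ := ihL hus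
        refine ⟨PlaneTree.node [T', R], .node _ _ hT' hR, by simpa using hne, ?_, ?_⟩
        · rcases hfl with h | h
          · exact Or.inl ⟨deepL _ h.1, deepL _ h.2⟩
          · exact Or.inr ⟨deepL _ h.1, deepL _ h.2⟩
        · intro k U hU h
          rcases h.cases_of_isBinary hU with ⟨A', B', C', -, -, -, h1, -⟩ |
            ⟨u', s', b', hu', hb', hus', ⟨rfl, h1⟩ | ⟨rfl, h1⟩⟩
          · simp at h1
          · simp only [PlaneTree.node.injEq, List.cons.injEq, and_true] at h1
            obtain ⟨rfl, rfl⟩ := h1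
            rcases huniq k u' hu' hus' with rfl | rfl <;> simp
          · simp only [PlaneTree.node.injEq, List.cons.injEq, and_true] at h1
            obtain ⟨rfl, rfl⟩ := h1
            exact absurd hus' (not_edge hu' hR)
      · simp only [PlaneTree.node.injEq, List.cons.injEq, and_true] at h1
        obtain ⟨rfl, rfl⟩ := h1
        obtain ⟨T', hT', hne, hfl, huniq⟩ := ihR hus
        refine ⟨PlaneTree.node [L, T'], .node _ _ hL hT', by simpa using hne, ?_, ?_⟩
        · rcases hfl with h | h
          · exact Or.inl ⟨deepR _ h.1, deepR _ h.2⟩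
          · exact Or.inr ⟨deepR _ h.1, deepR _ h.2⟩
        · intro k U hU h
          rcases h.cases_of_isBinary hU with ⟨A', B', C', -, -, -, h1, -⟩ |
            ⟨u', s', b', hu', hb', hus', ⟨rfl, h1⟩ | ⟨rfl, h1⟩⟩
          · simp at h1
          · simp only [PlaneTree.node.injEq, List.cons.injEq, and_true] at h1
            obtain ⟨rfl, rfl⟩ := h1
            exact absurd hus' (not_edge hu' hL)
          · simp only [PlaneTree.node.injEq, List.cons.injEq, and_true] at h1
            obtain ⟨rfl, rfl⟩ := h1
            rcases huniq k u' hu' hus' with rfl | rfl <;> simp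

/-- Each contraction removes one internal vertex, and `S` has just one fewer than any binary tree
with as many leaves, so the contraction sequence has length one. -/
theorem ContractsTo.edge_of_isBinary {U T S : PlaneTree} {j : ℕ} (hU : U.IsBinary)
    (hT : T.IsBinary) (hTS : ContractsEdge j T S) (h : U.ContractsTo S) :
    ∃ k, ContractsEdge k U S := by
  have leaves_eq : ∀ {A B : PlaneTree}, A.ContractsTo B → A.numLeaves = B.numLeaves := by
    intro A B h
    induction h with
    | refl => rfl
    | tail _ hs ih => obtain ⟨j, hj⟩ := hs; exact ih.trans hj.leaves_and_brackets.1
  have h1 := hTS.numInternal_eq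
  have h2 := hTS.leaves_and_brackets.1
  have h3 := leaves_eq h
  have h4 := hU.numInternal_add_one
  have h5 := hT.numInternal_add_one
  rcases Relation.ReflTransGen.cases_head h with rfl | ⟨V, ⟨k, hk⟩, hV⟩
  · omega
  · rcases ContractsTo.eq_or_lt hV with rfl | h6
    · exact ⟨k, hk⟩
    · have := hk.numInternal_eq
      omega

/-! ### The vertices of the Loday associahedron -/

theorem subtreeAt_pair (L R : PlaneTree) (i : ℕ) (hi : i + 1 < L.numLeaves + R.numLeaves) :
    (node [L, R]).subtreeAt i =
      if i + 1 < L.numLeaves then L.subtreeAt i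
      else if i + 1 = L.numLeaves then node [L, R]
      else R.subtreeAt (i - L.numLeaves) := by
  have := numLeaves_pos L
  rw [subtreeAt, subtreeAt.go, subtreeAt.go]
  split_ifs <;> first | omega | rfl

end PlaneTree

/-! ### Monotonicity of the gaps of initial sums -/

theorem initialSum_zero {n : ℕ} (α : Fin n → ℝ) : initialSum α 0 = 0 := by
  simp [initialSum]

theorem initialSum_succ {n : ℕ} (α : Fin n → ℝ) {t : ℕ} (ht : t < n) :
    initialSum α (t + 1) = initialSum α t + α ⟨t, ht⟩ := by
  unfold initialSum
  have : (Finset.univ.filter fun k : Fin n => k.val < t + 1) =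
      insert ⟨t, ht⟩ (Finset.univ.filter fun k : Fin n => k.val < t) := by
    ext k
    simp [Fin.ext_iff]
    omega
  rw [this, Finset.sum_insert (by simp), add_comm]

/-- Raising `x` by one adds the entry of `α` at index `x + y + 1` and removes the one at index `x`,
a positive change. -/
theorem initialSum_gap_lt {n : ℕ} {α : Fin n → ℝ} (hα : StrictMono α) {x x' y : ℕ} (hx : x < x')
    (h : x' + y + 1 ≤ n) :
    initialSum α (x + y + 1) - initialSum α x - initialSum α y <
      initialSum α (x' + y + 1) - initialSum α x' - initialSum α y := by
  induction x', hx using Nat.le_induction with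
  | base =>
    have e : x + 1 + y + 1 = (x + y + 1) + 1 := by ring
    rw [Nat.succ_eq_add_one, e, initialSum_succ α (show x + y + 1 < n by omega),
      initialSum_succ α (show x < n by omega)]
    have := hα (show (⟨x, by omega⟩ : Fin n) < ⟨x + y + 1, by omega⟩ by rw [Fin.mk_lt_mk]; omega)
    linarith
  | succ m hm ih =>
    refine (ih (by omega)).trans ?_
    have e : m + 1 + y + 1 = (m + y + 1) + 1 := by ring
    rw [e, initialSum_succ α (show m + y + 1 < n by omega),
      initialSum_succ α (show m < n by omega)]
    have := hα (show (⟨m, by omega⟩ : Fin n) < ⟨m + y + 1, by omega⟩ by rw [Fin.mk_lt_mk]; omega)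
    linarith

theorem initialSum_gap_le {n : ℕ} {α : Fin n → ℝ} (hα : StrictMono α) {x x' y y' : ℕ} (hx : x ≤ x')
    (hy : y ≤ y') (h : x' + y' + 1 ≤ n) :
    initialSum α (x + y + 1) - initialSum α x - initialSum α y ≤
      initialSum α (x' + y' + 1) - initialSum α x' - initialSum α y' ∧
    (initialSum α (x + y + 1) - initialSum α x - initialSum α y =
      initialSum α (x' + y' + 1) - initialSum α x' - initialSum α y' → x = x' ∧ y = y') := by
  have h1 : x < x' → initialSum α (x + y + 1) - initialSum α x - initialSum α y <
      initialSum α (x' + y + 1) - initialSum α x' - initialSum α y :=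
    fun hx => initialSum_gap_lt hα hx (by omega)
  have h2 : y < y' → initialSum α (x' + y + 1) - initialSum α x' - initialSum α y <
      initialSum α (x' + y' + 1) - initialSum α x' - initialSum α y' := by
    intro hy
    have := initialSum_gap_lt hα hy (y := x') (by omega)
    rw [add_comm x' y, add_comm x' y']
    linarith
  rcases hx.eq_or_lt with rfl | hx <;> rcases hy.eq_or_lt with rfl | hy
  · simp
  · exact ⟨(h2 hy).le, fun h => absurd h (h2 hy).ne⟩
  · exact ⟨(h1 hx).le, fun h => absurd h (h1 hx).ne⟩
  · exact ⟨((h1 hx).trans (h2 hy)).le, fun h => absurd h ((h1 hx).trans (h2 hy)).ne⟩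

namespace PlaneTree

/-- An interval within one subtree is handled by induction. One that contains the root gap has `x`
coordinates to its left and `y` to its right; the two sides contribute at least the initial sums of
`x` and `y`, and the root value is at least the gap for `(x, y)`, since both are bounded by the
subtree sizes. Equality forces the interval to be everything, the bracket of the root. -/
theorem sum_treeVal_subtreeAt {n : ℕ} {α : Fin n → ℝ} (hα : StrictMono α) {T : PlaneTree}
    (hT : T.IsBinary) (hn : T.numLeaves ≤ n + 1) (o : ℕ) :
    (∑ i ∈ Finset.Ico o (o + T.numLeaves - 1), treeVal α (T.subtreeAt (i - o)) =
      initialSum α (T.numLeaves - 1)) ∧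
    ∀ a b, o ≤ a → a ≤ b → b + 1 ≤ o + T.numLeaves →
      initialSum α (b - a) ≤ ∑ i ∈ Finset.Ico a b, treeVal α (T.subtreeAt (i - o)) ∧
      (a < b → (∑ i ∈ Finset.Ico a b, treeVal α (T.subtreeAt (i - o)) = initialSum α (b - a) ↔
        IsBracket [T] o a b)) := by
  induction hT generalizing o with
  | leaf =>
    refine ⟨by simp [initialSum_zero], fun a b h1 h2 h3 => ?_⟩
    simp at h3
    obtain rfl : a = b := by omega
    simp [initialSum_zero]
  | node L R hL hR ihL ihR =>
    rw [numLeaves_pair] at hn ⊢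
    have lpos := numLeaves_pos L
    have rpos := numLeaves_pos R
    obtain ⟨hLtot, hLsub⟩ := ihL (by omega) o
    obtain ⟨hRtot, hRsub⟩ := ihR (by omega) (o + L.numLeaves)
    have iL := hL.numInternal_add_one
    have iR := hR.numInternal_add_one
    set k := L.numLeaves with hk
    set m := R.numLeaves with hm
    set v : ℕ → ℝ := fun i => treeVal α ((PlaneTree.node [L, R]).subtreeAt (i - o)) with hv
    have sumL : ∀ a b, o ≤ a → b + 1 ≤ o + k → ∑ i ∈ Finset.Ico a b, v i =
        ∑ i ∈ Finset.Ico a b, treeVal α (L.subtreeAt (i - o)) := by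
      intro a b ha hb
      refine Finset.sum_congr rfl fun i hi => ?_
      rw [Finset.mem_Ico] at hi
      simp only [hv]
      rw [subtreeAt_pair _ _ _ (by omega), if_pos (by omega)]
    have sumR : ∀ a b, o + k ≤ a → b + 1 ≤ o + (k + m) → ∑ i ∈ Finset.Ico a b, v i =
        ∑ i ∈ Finset.Ico a b, treeVal α (R.subtreeAt (i - (o + k))) := by
      intro a b ha hb
      refine Finset.sum_congr rfl fun i hi => ?_
      rw [Finset.mem_Ico] at hi
      simp only [hv]
      rw [subtreeAt_pair _ _ _ (by omega), if_neg (by omega), if_neg (by omega), ← hk,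
        Nat.sub_sub]
    have vroot : v (o + k - 1) =
        initialSum α (k - 1 + (m - 1) + 1) - initialSum α (k - 1) - initialSum α (m - 1) := by
      simp only [hv]
      rw [subtreeAt_pair _ _ _ (by omega), if_neg (by omega), if_pos (by omega), treeVal,
        numInternal_pair]
      congr 3 <;> omega
    have sumSplit : ∀ a b, a ≤ o + k - 1 → o + k ≤ b → ∑ i ∈ Finset.Ico a b, v i =
        ∑ i ∈ Finset.Ico a (o + k - 1), v i + v (o + k - 1) + ∑ i ∈ Finset.Ico (o + k) b, v i := by
      intro a b ha hb
      rw [← Finset.sum_Ico_consecutive v (show a ≤ o + k by omega) hb]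
      congr 1
      have := Finset.sum_Ico_succ_top ha v
      rwa [show o + k - 1 + 1 = o + k by omega] at this
    have br : ∀ a b, IsBracket [PlaneTree.node [L, R]] o a b ↔
        (a = o ∧ b + 1 = o + (k + m)) ∨ IsBracket [L] o a b ∨ IsBracket [R] (o + k) a b := by
      intro a b
      rw [isBracket_singleton, isBracket_cons]
      simp [hk, hm]
    have bL : ∀ {a b}, IsBracket [L] o a b → b + 1 ≤ o + k := fun h => by
      simpa using (h.bounds (by simpa using hL.strictlyBranching)).2.2
    have bR : ∀ {a b}, IsBracket [R] (o + k) a b → o + k ≤ a := fun h =>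
      (h.bounds (by simpa using hR.strictlyBranching)).1
    refine ⟨?_, ?_⟩
    · rw [sumSplit _ _ (by omega) (by omega), sumL _ _ le_rfl (by omega),
        sumR _ _ le_rfl (by omega), hLtot, vroot,
        show o + (k + m) - 1 = o + k + m - 1 by omega, hRtot,
        show k - 1 + (m - 1) + 1 = k + m - 1 by omega]
      ring
    · intro a b ha hab hb
      by_cases h1 : b + 1 ≤ o + k
      · rw [sumL a b ha h1]
        obtain ⟨g1, g2⟩ := hLsub a b ha hab h1
        refine ⟨g1, fun hlt => ?_⟩
        rw [g2 hlt, br]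
        refine ⟨fun h => Or.inr (Or.inl h), ?_⟩
        rintro (h | h | h)
        · omega
        · exact h
        · have := bR h; omega
      · by_cases h2 : o + k ≤ a
        · rw [sumR a b h2 (by omega)]
          obtain ⟨g1, g2⟩ := hRsub a b h2 hab (by omega)
          refine ⟨g1, fun hlt => ?_⟩
          rw [g2 hlt, br]
          refine ⟨fun h => Or.inr (Or.inr h), ?_⟩
          rintro (h | h | h)
          · omega
          · have := bL h; omega
          · exact h
        · rw [sumSplit a b (by omega) (by omega), sumL _ _ ha (by omega), sumR _ _ le_rfl hb, vroot]
          obtain ⟨g1, -⟩ := hLsub a (o + k - 1) ha (by omega) (by omega)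
          obtain ⟨g2, -⟩ := hRsub (o + k) b le_rfl (by omega) (by omega)
          have gle := initialSum_gap_le hα (show o + k - 1 - a ≤ k - 1 by omega)
            (show b - (o + k) ≤ m - 1 by omega) (by omega)
          rw [show o + k - 1 - a + (b - (o + k)) + 1 = b - a by omega] at gle
          refine ⟨by linarith [gle.1], fun _ => ⟨fun h => ?_, fun h => ?_⟩⟩
          · have := gle.2 (by linarith [gle.1])
            rw [br]
            left; omega
          · rw [br] at h
            obtain ⟨rfl, h⟩ : a = o ∧ b + 1 = o + (k + m) := by
              rcases h with h | h | h
              · exact h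
              · have := bL h; omega
              · have := bR h; omega
            rw [hLtot, show b = a + k + m - 1 by omega, hRtot,
              show a + k + m - 1 - a = k - 1 + (m - 1) + 1 by omega]
            ring

end PlaneTree

open PlaneTree

/-! ### Brackets of a weight function -/

/-- The interval `[a, b)` inside `[lo, hi)` is bounded on both sides by positions at which the weight
is larger than everywhere in the interval; the weight just outside `[lo, hi)` counts as `W`. -/
def WeightBracket (w : ℕ → ℝ) (W : ℝ) (lo hi a b : ℕ) : Prop :=
  lo ≤ a ∧ a < b ∧ b ≤ hi ∧ ∀ i, a ≤ i → i < b →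
    (a = lo → w i < W) ∧ (∀ j, lo ≤ j → j + 1 = a → w i < w j) ∧
      (b = hi → w i < W) ∧ (b < hi → w i < w b)

/-- No bracket contains `p`, as nothing outside it exceeds the maximal weight `W`. For the two
remaining pieces, `p` plays the role of an outside neighbour of weight `W`. -/
theorem weightBracket_split {w : ℕ → ℝ} {W : ℝ} {lo hi p : ℕ} (hlo : lo ≤ p) (hhi : p < hi)
    (hw : ∀ i, lo ≤ i → i < hi → w i ≤ W) (hp : w p = W) (a b : ℕ) :
    WeightBracket w W lo hi a b ↔
      WeightBracket w W lo p a b ∨ WeightBracket w W (p + 1) hi a b := by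
  constructor
  · rintro ⟨h1, h2, h3, h⟩
    have hout : b ≤ p ∨ p + 1 ≤ a := by
      by_contra! hc
      obtain ⟨g1, g2, -, -⟩ := h p (by omega) (by omega)
      rcases h1.eq_or_lt with h1 | h1
      · exact absurd (g1 h1.symm) (by simp [hp])
      · have g3 := g2 (a - 1) (by omega) (by omega)
        have := hw (a - 1) (by omega) (by omega)
        linarith
    rcases hout with hb | ha
    · refine Or.inl ⟨h1, h2, hb, fun i hi1 hi2 => ?_⟩
      obtain ⟨g1, g2, -, g4⟩ := h i hi1 hi2
      refine ⟨g1, g2, fun h => ?_, fun _ => g4 (by omega)⟩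
      rw [← hp, ← h]
      exact g4 (by omega)
    · refine Or.inr ⟨ha, h2, h3, fun i hi1 hi2 => ?_⟩
      obtain ⟨-, g2, g3, g4⟩ := h i hi1 hi2
      refine ⟨fun h => ?_, fun j hj1 hj2 => g2 j (by omega) hj2, g3, g4⟩
      rw [← hp]
      exact g2 p hlo h.symm
  · rintro (⟨h1, h2, h3, h⟩ | ⟨h1, h2, h3, h⟩)
    · refine ⟨h1, h2, by omega, fun i hi1 hi2 => ?_⟩
      obtain ⟨g1, g2, g3, g4⟩ := h i hi1 hi2
      refine ⟨g1, g2, fun _ => by omega, fun _ => ?_⟩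
      rcases h3.eq_or_lt with h3 | h3
      · rw [h3, hp]; exact g3 h3
      · exact g4 h3
    · refine ⟨by omega, h2, h3, fun i hi1 hi2 => ?_⟩
      obtain ⟨g1, g2, g3, g4⟩ := h i hi1 hi2
      refine ⟨fun _ => by omega, fun j hj1 hj2 => ?_, g3, g4⟩
      rcases h1.eq_or_lt with h1 | h1
      · obtain rfl : j = p := by omega
        rw [hp]; exact g1 h1.symm
      · exact g2 j (by omega) hj2

/-- A proper subinterval has a neighbour inside `[lo, hi)`, of weight at most `m`, that already
dominates it; so raising the outer weight above `m` creates only the full interval. -/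
theorem weightBracket_raise {w : ℕ → ℝ} {W m : ℝ} {lo hi : ℕ} (hlt : lo < hi) (hm : m < W)
    (hw : ∀ i, lo ≤ i → i < hi → w i ≤ m) (a b : ℕ) :
    WeightBracket w W lo hi a b ↔ WeightBracket w m lo hi a b ∨ (a = lo ∧ b = hi) := by
  constructor
  · rintro ⟨h1, h2, h3, h⟩
    by_cases hab : a = lo ∧ b = hi
    · exact Or.inr hab
    refine Or.inl ⟨h1, h2, h3, fun i hi1 hi2 => ?_⟩
    obtain ⟨g1, g2, g3, g4⟩ := h i hi1 hi2
    have key : w i < m := by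
      rcases h1.eq_or_lt with h1 | h1
      · exact (g4 (by omega)).trans_le (hw b (by omega) (by omega))
      · exact (g2 (a - 1) (by omega) (by omega)).trans_le (hw _ (by omega) (by omega))
    exact ⟨fun _ => key, g2, fun _ => key, g4⟩
  · rintro (⟨h1, h2, h3, h⟩ | ⟨rfl, rfl⟩)
    · refine ⟨h1, h2, h3, fun i hi1 hi2 => ?_⟩
      obtain ⟨g1, g2, g3, g4⟩ := h i hi1 hi2
      exact ⟨fun h => (g1 h).trans hm, g2, fun h => (g3 h).trans hm, g4⟩
    · refine ⟨le_rfl, hlt, le_rfl, fun i hi1 hi2 => ?_⟩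
      have := (hw i hi1 hi2).trans_lt hm
      exact ⟨fun _ => this, fun j _ _ => by omega, fun _ => this, fun _ => by omega⟩

theorem not_weightBracket_empty (w : ℕ → ℝ) (W : ℝ) (lo a b : ℕ) :
    ¬ WeightBracket w W lo lo a b := by
  rintro ⟨h1, h2, h3, -⟩; omega

/-- Induction on intervals along the recursive decomposition of a weight function: cut at a position
with the maximal weight allowed, or lower the maximal weight allowed. -/
theorem weight_induction (w : ℕ → ℝ) {Q : ℝ → ℕ → ℕ → Prop} (empty : ∀ W lo, Q W lo lo)
    (split : ∀ W lo p hi, lo ≤ p → p < hi → (∀ i, lo ≤ i → i < hi → w i ≤ W) → w p = W →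
      Q W lo p → Q W (p + 1) hi → Q W lo hi)
    (raise : ∀ W m lo p hi, lo ≤ p → p < hi → m < W → (∀ i, lo ≤ i → i < hi → w i ≤ m) → w p = m →
      Q m lo hi → Q W lo hi) :
    ∀ lo hi W, lo ≤ hi → (∀ i, lo ≤ i → i < hi → w i ≤ W) → Q W lo hi := by
  have key : ∀ N lo hi W, hi - lo ≤ N → lo ≤ hi → (∀ i, lo ≤ i → i < hi → w i ≤ W) → Q W lo hi := by
    intro N
    induction N with
    | zero =>
      intro lo hi W h1 h2 _
      obtain rfl : lo = hi := by omega
      exact empty W lo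
    | succ N ih =>
      intro lo hi W h1 h2 hw
      rcases h2.eq_or_lt with rfl | h2
      · exact empty W lo
      obtain ⟨p, hp, hmax⟩ := Finset.exists_max_image (Finset.Ico lo hi) w ⟨lo, by simpa using h2⟩
      rw [Finset.mem_Ico] at hp
      have hmax' : ∀ i, lo ≤ i → i < hi → w i ≤ w p := fun i h3 h4 => hmax i (by simp [h3, h4])
      -- Cut at a maximum with the cap equal to the maximal weight, then raise the cap to `W` if it
      -- is larger.
      have hQ : Q (w p) lo hi := split (w p) lo p hi hp.1 hp.2 hmax' rfl
        (ih _ _ _ (by omega) hp.1 fun i h3 h4 => hmax' i h3 (by omega))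
        (ih _ _ _ (by omega) hp.2 fun i h3 h4 => hmax' i (by omega) h4)
      rcases (hw p hp.1 hp.2).eq_or_lt with h | h
      · rwa [h] at hQ
      · exact raise W (w p) lo p hi hp.1 hp.2 h hmax' rfl hQ
  exact fun lo hi W h1 h2 => key _ lo hi W le_rfl h1 h2

/-! ### Abel summation, and trees from weights and back -/

theorem sum_Ico_split {z : ℕ → ℝ} {lo p hi : ℕ} (hlo : lo ≤ p) (hhi : p < hi) :
    ∑ i ∈ Finset.Ico lo hi, z i =
      ∑ i ∈ Finset.Ico lo p, z i + z p + ∑ i ∈ Finset.Ico (p + 1) hi, z i := by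
  rw [← Finset.sum_Ico_succ_top hlo, Finset.sum_Ico_consecutive _ (by omega) (by omega)]

/-- Abel summation along the decomposition: a cut is exact, since the cut position has weight `W`.
Raising the cap from `m` to `W` costs `W - m` times a bracket sum, which is nonnegative, and overall
equality makes each such cost vanish. -/
theorem sum_weight_le (w z : ℕ → ℝ) (lo hi : ℕ) (W : ℝ) (h : lo ≤ hi)
    (hw : ∀ i, lo ≤ i → i < hi → w i ≤ W) :
    (∀ a b, WeightBracket w W lo hi a b → 0 ≤ ∑ i ∈ Finset.Ico a b, z i) →
    ∑ i ∈ Finset.Ico lo hi, w i * z i ≤ W * ∑ i ∈ Finset.Ico lo hi, z i ∧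
    (∑ i ∈ Finset.Ico lo hi, w i * z i = W * ∑ i ∈ Finset.Ico lo hi, z i →
      ∀ a b, WeightBracket w W lo hi a b → ∑ i ∈ Finset.Ico a b, z i = 0) := by
  revert h hw
  revert lo hi W
  refine weight_induction w ?_ ?_ ?_
  · intro W lo _
    simp [not_weightBracket_empty]
  · intro W lo p hi hlo hhi hw hp h1 h2 hz
    have hs := weightBracket_split hlo hhi hw hp
    obtain ⟨h1, h1'⟩ := h1 fun a b hb => hz a b ((hs a b).mpr (Or.inl hb))
    obtain ⟨h2, h2'⟩ := h2 fun a b hb => hz a b ((hs a b).mpr (Or.inr hb))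
    rw [sum_Ico_split (z := z) hlo hhi, sum_Ico_split (z := fun i => w i * z i) hlo hhi, hp]
    refine ⟨by linarith, fun heq a b hb => ?_⟩
    rcases (hs a b).mp hb with hb | hb
    · exact h1' (by linarith) a b hb
    · exact h2' (by linarith) a b hb
  · intro W m lo p hi hlo hhi hm hw hp h1 hz
    have hs := weightBracket_raise (lo := lo) (hi := hi) (by omega) hm hw
    obtain ⟨h1, h1'⟩ := h1 fun a b hb => hz a b ((hs a b).mpr (Or.inl hb))
    have h0 := hz lo hi ((hs _ _).mpr (Or.inr ⟨rfl, rfl⟩))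
    have h3 : m * ∑ i ∈ Finset.Ico lo hi, z i ≤ W * ∑ i ∈ Finset.Ico lo hi, z i :=
      mul_le_mul_of_nonneg_right hm.le h0
    refine ⟨h1.trans h3, fun heq a b hb => ?_⟩
    rcases (hs a b).mp hb with hb | ⟨rfl, rfl⟩
    · exact h1' (le_antisymm h1 (by linarith)) a b hb
    · have h4 : (W - m) * ∑ i ∈ Finset.Ico a b, z i = 0 := by linarith
      exact (mul_eq_zero.mp h4).resolve_left (by linarith)

/-- Every weight function is realized by a forest. -/
theorem exists_forest_of_weight (w : ℕ → ℝ) (lo hi : ℕ) (W : ℝ) (h : lo ≤ hi)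
    (hw : ∀ i, lo ≤ i → i < hi → w i ≤ W) :
    ∃ F : List PlaneTree, F ≠ [] ∧ (∀ t ∈ F, t.StrictlyBranching) ∧ lo + leaves F = hi + 1 ∧
      (∀ a b, IsBracket F lo a b ↔ WeightBracket w W lo hi a b) ∧
      ((∀ i, lo ≤ i → i < hi → w i < W) → F.length = 1) ∧
      ((∃ p, lo ≤ p ∧ p < hi ∧ w p = W) → 2 ≤ F.length) ∧
      (Set.InjOn w (Set.Ico lo hi) → (∀ t ∈ F, t.IsBinary) ∧ F.length ≤ 2) := by
  revert h hw
  revert lo hi W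
  refine weight_induction w ?_ ?_ ?_
  · intro W lo
    refine ⟨[PlaneTree.node []], by simp, by simp [IsBinary.leaf.strictlyBranching], by simp, ?_,
      by simp, ?_, by simp [IsBinary.leaf]⟩
    · intro a b
      simp [not_weightBracket_empty, isBracket_singleton]
    · rintro ⟨p, h1, h2, -⟩; omega
  · rintro W lo p hi hlo hhi hw hp ⟨F, F0, FS, Fl, Fb, F1, F2, Fi⟩ ⟨G, G0, GS, Gl, Gb, G1, G2, Gi⟩
    refine ⟨F ++ G, by simp [F0], ?_, by simp; omega, ?_, ?_, ?_, ?_⟩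
    · intro t ht
      rcases List.mem_append.mp ht with h | h
      · exact FS t h
      · exact GS t h
    · intro a b
      rw [isBracket_append, Fl, Fb, Gb, weightBracket_split hlo hhi hw hp]
    · intro h
      exact absurd hp (h p hlo hhi).ne
    · intro _
      have := List.length_pos_iff.mpr F0
      have := List.length_pos_iff.mpr G0
      simp; omega
    · intro hinj
      have hne : ∀ i, lo ≤ i → i < hi → i ≠ p → w i < W := fun i h1 h2 h3 =>
        lt_of_le_of_ne (hw i h1 h2) fun h => h3 (hinj ⟨h1, h2⟩ ⟨hlo, hhi⟩ (h.trans hp.symm))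
      have f1 := F1 fun i h1 h2 => hne i h1 (by omega) (by omega)
      have g1 := G1 fun i h1 h2 => hne i (by omega) h2 (by omega)
      have f2 := (Fi (hinj.mono (Set.Ico_subset_Ico le_rfl hhi.le))).1
      have g2 := (Gi (hinj.mono (Set.Ico_subset_Ico (by omega) le_rfl))).1
      refine ⟨fun t ht => ?_, by simp [f1, g1]⟩
      rcases List.mem_append.mp ht with h | h
      · exact f2 t h
      · exact g2 t h
  · rintro W m lo p hi hlo hhi hm hw hp ⟨F, F0, FS, Fl, Fb, F1, F2, Fi⟩
    -- A position attaining the cap `m` guarantees at least two trees, as needed for a new strictly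
    -- branching root.
    have F2 := F2 ⟨p, hlo, hhi, hp⟩
    refine ⟨[PlaneTree.node F], by simp, ?_, by simpa [numLeaves_node F0] using Fl, ?_, by simp,
      ?_, ?_⟩
    · simpa [strictlyBranching_node_iff] using ⟨Or.inr F2, FS⟩
    · intro a b
      rw [isBracket_singleton, Fb, weightBracket_raise (by omega) hm hw, or_comm]
      simp only [ne_eq, F0, not_false_eq_true, true_and, Fl, Nat.add_right_cancel_iff]
    · rintro ⟨q, h1, h2, h3⟩
      have := hw q h1 h2
      linarith
    · intro hinj
      obtain ⟨h1, h2⟩ := Fi hinj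
      obtain ⟨L, R, rfl⟩ := List.length_eq_two.mp (le_antisymm h2 F2)
      simp only [List.mem_cons, List.not_mem_nil, or_false, forall_eq_or_imp, forall_eq] at h1
      simpa using IsBinary.node _ _ h1.1 h1.2

theorem exists_tree_of_weight {w : ℕ → ℝ} {n : ℕ} {W : ℝ} (hw : ∀ i < n, w i < W) :
    ∃ T : PlaneTree, T.StrictlyBranching ∧ T.numLeaves = n + 1 ∧
      (∀ a b, IsBracket [T] 0 a b ↔ WeightBracket w W 0 n a b) ∧
      (Set.InjOn w (Set.Iio n) → T.IsBinary) := by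
  obtain ⟨F, -, h1, h2, h3, h4, -, h5⟩ :=
    exists_forest_of_weight w 0 n W (Nat.zero_le n) fun i _ hi => (hw i hi).le
  obtain ⟨T, rfl⟩ := List.length_eq_one_iff.mp (h4 fun i _ hi => hw i hi)
  refine ⟨T, by simpa using h1, by simpa using h2, h3, fun hi => ?_⟩
  simpa using (h5 (hi.mono fun i hi => hi.2)).1

/-- Every strictly branching tree is realized by a weight function. -/
theorem exists_weight_of_forest (F : List PlaneTree) (hF : ∀ t ∈ F, t.StrictlyBranching)
    (hne : F ≠ []) (lo hi : ℕ) (W : ℝ) (hl : lo + leaves F = hi + 1) :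
    ∃ w : ℕ → ℝ, (∀ i, lo ≤ i → i < hi → w i ≤ W) ∧
      ∀ a b, IsBracket F lo a b ↔ WeightBracket w W lo hi a b := by
  have congr : ∀ {w w' : ℕ → ℝ} {W lo hi}, (∀ i, lo ≤ i → i < hi → w i = w' i) → ∀ a b,
      (WeightBracket w W lo hi a b ↔ WeightBracket w' W lo hi a b) := by
    intro w w' W lo hi h a b
    have one : ∀ {w w' : ℕ → ℝ}, (∀ i, lo ≤ i → i < hi → w i = w' i) →
        WeightBracket w W lo hi a b → WeightBracket w' W lo hi a b := by
      rintro w w' h ⟨h1, h2, h3, h4⟩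
      refine ⟨h1, h2, h3, fun i hi1 hi2 => ?_⟩
      obtain ⟨g1, g2, g3, g4⟩ := h4 i hi1 hi2
      rw [← h i (by omega) (by omega)]
      refine ⟨g1, fun j hj1 hj2 => ?_, g3, fun hb => ?_⟩
      · rw [← h j hj1 (by omega)]; exact g2 j hj1 hj2
      · rw [← h b (by omega) hb]; exact g4 hb
    exact ⟨one h, one fun i h1 h2 => (h i h1 h2).symm⟩
  induction F using forest_induction generalizing lo hi W with
  | nil => exact absurd rfl hne
  | cons cs ds ihc ihd =>
    simp only [List.mem_cons, forall_eq_or_imp] at hF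
    obtain ⟨hC, hds⟩ := hF
    obtain ⟨hC1, hC2⟩ := strictlyBranching_node_iff.mp hC
    have head : ∀ hi, lo + (PlaneTree.node cs).numLeaves = hi + 1 →
        ∃ w : ℕ → ℝ, (∀ i, lo ≤ i → i < hi → w i ≤ W) ∧
          ∀ a b, IsBracket [PlaneTree.node cs] lo a b ↔ WeightBracket w W lo hi a b := by
      intro hi hl
      by_cases hcs : cs = []
      · subst hcs
        obtain rfl : hi = lo := by simp at hl; omega
        exact ⟨fun _ => W, fun _ _ _ => le_rfl, fun a b => by
          simp [not_weightBracket_empty, isBracket_singleton]⟩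
      · rw [numLeaves_node hcs] at hl
        -- Descending one level lowers the cap by one, so the weight of a gap is, up to a constant,
        -- minus the depth of its vertex.
        obtain ⟨w, hw, hb⟩ := ihc hC2 hcs lo hi (W - 1) hl
        have h2 := hC1.resolve_left hcs
        have h3 := length_le_leaves cs
        refine ⟨w, fun i h1 h2 => by linarith [hw i h1 h2], fun a b => ?_⟩
        rw [isBracket_singleton, weightBracket_raise (by omega) (by linarith : W - 1 < W) hw, hb,
          or_comm, hl]
        simp [hcs]
    by_cases hd : ds = []
    · subst hd
      exact head hi (by simpa using hl)
    · have hpos := numLeaves_pos (PlaneTree.node cs)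
      have hdl := length_le_leaves ds
      have hdp := List.length_pos_iff.mpr hd
      simp only [leaves_cons] at hl
      obtain ⟨p, hp⟩ : ∃ p, lo + (PlaneTree.node cs).numLeaves = p + 1 :=
        ⟨lo + (PlaneTree.node cs).numLeaves - 1, by omega⟩
      obtain ⟨w₁, hw₁, hb₁⟩ := head p hp
      obtain ⟨w₂, hw₂, hb₂⟩ := ihd hds hd (p + 1) hi W (by omega)
      -- The gap `p` between the first tree and the rest of the forest gets the maximal weight.
      set w : ℕ → ℝ := fun i => if i < p then w₁ i else if i = p then W else w₂ i with hw
      have e1 : ∀ i, lo ≤ i → i < p → w i = w₁ i := fun i _ h => by simp [hw, h]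
      have e2 : ∀ i, p + 1 ≤ i → i < hi → w i = w₂ i := fun i h _ => by
        simp [hw, show ¬ i < p by omega, show i ≠ p by omega]
      have e3 : w p = W := by simp [hw]
      have hle : ∀ i, lo ≤ i → i < hi → w i ≤ W := by
        intro i h1 h2
        rcases lt_trichotomy i p with h | h | h
        · rw [e1 i h1 h]; exact hw₁ i h1 h
        · rw [h, e3]
        · rw [e2 i h h2]; exact hw₂ i h h2
      refine ⟨w, hle, fun a b => ?_⟩
      rw [isBracket_cons, hp, hb₁, hb₂, weightBracket_split (by omega) (by omega) hle e3,
        congr e1, congr e2]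

theorem exists_weight_of_tree {T : PlaneTree} (hT : T.StrictlyBranching) {n : ℕ} (hn : 1 ≤ n)
    (hl : T.numLeaves = n + 1) :
    ∃ w : ℕ → ℝ, (∀ i < n, w i < 0) ∧ ∀ a b, IsBracket [T] 0 a b ↔ WeightBracket w 0 0 n a b := by
  obtain ⟨w, hw, hb⟩ := exists_weight_of_forest [T] (by simpa using hT) (by simp) 0 n 0
    (by simpa using hl)
  refine ⟨w, fun i hi => ?_, hb⟩
  obtain ⟨cs⟩ := T
  have hcs : cs ≠ [] := by rintro rfl; simp at hl; omega
  rw [numLeaves_node hcs] at hl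
  -- The root bracket touches both ends, so being a weight bracket makes every weight strictly
  -- smaller than the cap `0`.
  have := (hb 0 n).mp ((isBracket_singleton _ _ _ _).mpr (Or.inl ⟨hcs, rfl, by omega⟩))
  exact (this.2.2.2 i (Nat.zero_le i) hi).1 rfl

/-- Ties in a weight function can be broken, with a prescribed preference for one pair. -/
theorem exists_injOn_weight (w : ℕ → ℝ) (n : ℕ) (i₀ j₀ : ℕ) (h : w j₀ ≤ w i₀) (hne : i₀ ≠ j₀) :
    ∃ w' : ℕ → ℝ, Set.InjOn w' (Set.Iio n) ∧ (∀ i < n, ∀ j < n, w i < w j → w' i < w' j) ∧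
      w' j₀ < w' i₀ := by
  -- Perturb to `w + ε t` with `t` injective, of the sign that favours `i₀`, and `ε > 0` small
  -- enough to keep the finitely many strict inequalities.
  obtain ⟨t, ht, htlt⟩ : ∃ t : ℕ → ℝ, Function.Injective t ∧ t j₀ < t i₀ := by
    rcases lt_or_gt_of_ne hne with h | h
    · exact ⟨fun i => -i, fun i j hij => by simpa using hij, by simpa using h⟩
    · exact ⟨fun i => i, fun i j hij => by simpa using hij, by simpa using h⟩
  have hlim : ∀ i, Filter.Tendsto (fun ε : ℝ => w i + ε * t i) (nhdsWithin 0 (Set.Ioi 0))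
      (nhds (w i)) := by
    intro i
    have : Continuous fun ε : ℝ => w i + ε * t i := by fun_prop
    simpa using (this.tendsto 0).mono_left nhdsWithin_le_nhds
  have hev : ∀ᶠ ε : ℝ in nhdsWithin 0 (Set.Ioi 0), ∀ q ∈ Finset.range n ×ˢ Finset.range n,
      w q.1 < w q.2 → w q.1 + ε * t q.1 < w q.2 + ε * t q.2 := by
    rw [Filter.eventually_all_finset]
    rintro ⟨i, j⟩ -
    by_cases hij : w i < w j
    · filter_upwards [(hlim i).eventually_lt (hlim j) hij] with ε hε _ using hε
    · exact Filter.Eventually.of_forall fun _ h => absurd h hij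
  obtain ⟨ε, hε, hpos⟩ := (hev.and self_mem_nhdsWithin).exists
  have hpos : 0 < ε := hpos
  have hmono : ∀ i < n, ∀ j < n, w i < w j → w i + ε * t i < w j + ε * t j :=
    fun i hi j hj => hε (i, j) (by simp [hi, hj])
  refine ⟨fun i => w i + ε * t i, fun i hi j hj hij => ?_, hmono, ?_⟩
  · rcases lt_trichotomy (w i) (w j) with h | h | h
    · exact absurd hij (hmono i hi j hj h).ne
    · simp only [h, add_right_inj] at hij
      exact ht (mul_left_cancel₀ hpos.ne' hij)
    · exact absurd hij.symm (hmono j hj i hi h).ne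
  · have := mul_lt_mul_of_pos_left htlt hpos
    simp only
    linarith

/-- Brackets are defined by strict inequalities alone, so they persist whenever those do; the value
of a cap above all weights is immaterial. -/
theorem WeightBracket.of_monotone {w w' : ℕ → ℝ} {W W' : ℝ} {n a b : ℕ} (hW : ∀ i < n, w i < W)
    (h : ∀ i < n, ∀ j < n, w' i < w' j → w i < w j) (hb : WeightBracket w' W' 0 n a b) :
    WeightBracket w W 0 n a b := by
  obtain ⟨h1, h2, h3, h4⟩ := hb
  refine ⟨h1, h2, h3, fun i hi1 hi2 => ?_⟩
  obtain ⟨-, g2, -, g4⟩ := h4 i hi1 hi2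
  exact ⟨fun _ => hW i (by omega), fun j hj1 hj2 => h i (by omega) j (by omega) (g2 j hj1 hj2),
    fun _ => hW i (by omega), fun hb => h i (by omega) b hb (g4 hb)⟩

/-- Complete binary refinements of a strictly branching tree exist and detect its brackets. -/
theorem exists_binary_avoiding {T : PlaneTree} (hT : T.StrictlyBranching) {n : ℕ} (hn : 1 ≤ n)
    (hl : T.numLeaves = n + 1) {a b : ℕ} (hab : a < b) (hbn : b ≤ n)
    (hT' : ¬ IsBracket [T] 0 a b) :
    ∃ U : PlaneTree, U.IsBinary ∧ U.numLeaves = n + 1 ∧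
      (∀ a b, IsBracket [T] 0 a b → IsBracket [U] 0 a b) ∧ ¬ IsBracket [U] 0 a b := by
  obtain ⟨w, hw0, hw⟩ := exists_weight_of_tree hT hn hl
  -- A non-bracket has a neighbour `j` that fails to dominate some inner `i`. Breaking ties with `j`
  -- below `i` keeps this failure in the binary refinement.
  obtain ⟨i, j, hi, hib, hjn, hij, hj, hle⟩ : ∃ i j, a ≤ i ∧ i < b ∧ j < n ∧ i ≠ j ∧
      (j + 1 = a ∨ j = b) ∧ w j ≤ w i := by
    by_contra! hc
    refine hT' ((hw a b).mpr ⟨Nat.zero_le a, hab, hbn, fun i h1 h2 => ?_⟩)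
    have h0 := hw0 i (by omega)
    exact ⟨fun _ => h0, fun j _ hj => hc i j h1 h2 (by omega) (by omega) (Or.inl hj), fun _ => h0,
      fun hb => hc i b h1 h2 hb (by omega) (Or.inr rfl)⟩
  obtain ⟨w', hinj, hmono, hlt⟩ := exists_injOn_weight w n i j hle hij
  obtain ⟨W, hW⟩ : ∃ W, ∀ i < n, w' i < W := by
    obtain ⟨M, hM⟩ := ((Set.finite_Iio n).image w').bddAbove
    exact ⟨M + 1, fun i hi => by linarith [hM ⟨i, hi, rfl⟩]⟩
  obtain ⟨U, -, hU, hUb, hbin⟩ := exists_tree_of_weight hW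
  refine ⟨U, hbin hinj, hU, fun a b hb => ?_, fun hb => ?_⟩
  · rw [hUb]
    exact ((hw a b).mp hb).of_monotone hW hmono
  · obtain ⟨-, -, -, h4⟩ := (hUb a b).mp hb
    obtain ⟨-, g2, -, g4⟩ := h4 i hi hib
    rcases hj with hj | rfl
    · exact absurd (g2 j (Nat.zero_le j) hj) hlt.not_gt
    · exact absurd (g4 hjn) hlt.not_gt

/-! ### Interval sums on the Loday associahedron -/

/-- The extension of a vector by `0`. -/
def extendZero {n : ℕ} (x : Fin n → ℝ) (i : ℕ) : ℝ := if h : i < n then x ⟨i, h⟩ else 0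

@[simp] theorem extendZero_val {n : ℕ} (x : Fin n → ℝ) (i : Fin n) :
    extendZero x i.val = x i := by simp [extendZero]

/-- The sum of the coordinates with index in `[a, b)`. -/
def intervalSum {n : ℕ} (a b : ℕ) : (Fin n → ℝ) →ₗ[ℝ] ℝ where
  toFun x := ∑ i ∈ Finset.Ico a b, extendZero x i
  map_add' x y := by
    rw [← Finset.sum_add_distrib]
    refine Finset.sum_congr rfl fun i _ => ?_
    unfold extendZero; split_ifs <;> simp
  map_smul' c x := by
    simp only [RingHom.id_apply, smul_eq_mul, Finset.mul_sum]
    refine Finset.sum_congr rfl fun i _ => ?_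
    unfold extendZero; split_ifs <;> simp

theorem intervalSum_apply {n : ℕ} (a b : ℕ) (x : Fin n → ℝ) :
    intervalSum a b x = ∑ i ∈ Finset.Ico a b, extendZero x i := rfl

theorem intervalSum_full {n : ℕ} (x : Fin n → ℝ) : intervalSum 0 n x = ∑ i, x i := by
  rw [intervalSum_apply, ← Finset.range_eq_Ico, ← Fin.sum_univ_eq_sum_range]
  simp

theorem dotProduct_eq_sum_Ico {n : ℕ} (w x : Fin n → ℝ) :
    w ⬝ᵥ x = ∑ i ∈ Finset.Ico 0 n, extendZero w i * extendZero x i := by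
  rw [← Finset.range_eq_Ico, ← Fin.sum_univ_eq_sum_range (fun i => extendZero w i * extendZero x i)]
  simp [dotProduct]

theorem SBTree.exists_eq {n : ℕ} {T : PlaneTree} (h1 : T.StrictlyBranching)
    (h2 : T.numLeaves = n + 1) : ∃ S : SBTree n, S.1 = T := ⟨⟨T, h1, h2⟩, rfl⟩

theorem CBTree.isBinary {n : ℕ} (T : CBTree n) : T.1.1.IsBinary :=
  isBinary_of_numInternal T.1.2.1 (by rw [T.2, T.1.2.2])

theorem CBTree.exists_eq {n : ℕ} {T : PlaneTree} (h1 : T.IsBinary) (h2 : T.numLeaves = n + 1) :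
    ∃ S : CBTree n, S.1.1 = T :=
  ⟨⟨⟨T, h1.strictlyBranching, h2⟩, by have := h1.numInternal_add_one; simp only; omega⟩, rfl⟩

theorem SBTree.le_iff {n : ℕ} (hn : 1 ≤ n) {T S : SBTree n} :
    T ≤ S ↔ ∀ a b, IsBracket [S.1] 0 a b → IsBracket [T.1] 0 a b :=
  ⟨fun h _ _ hS => ContractsTo.isBracket h hS, fun h => contractsTo_of_isBracket T.2.1 S.2.1
    (T.2.2.trans S.2.2.symm) (by rw [T.2.2]; omega) h⟩

theorem SBTree.bracket_bounds {n : ℕ} (T : SBTree n) {a b : ℕ} (h : IsBracket [T.1] 0 a b) :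
    a < b ∧ b ≤ n := by
  have := h.bounds (by simpa using T.2.1)
  simp [T.2.2] at this
  omega

theorem SBTree.bracket_full {n : ℕ} (hn : 1 ≤ n) (T : SBTree n) : IsBracket [T.1] 0 0 n := by
  obtain ⟨⟨cs⟩, h1, h2⟩ := T
  have hcs : cs ≠ [] := by rintro rfl; simp at h2; omega
  rw [numLeaves_node hcs] at h2
  exact (isBracket_singleton _ _ _ _).mpr (Or.inl ⟨hcs, rfl, by omega⟩)

theorem intervalSum_lodayVertex {n : ℕ} {α : Fin n → ℝ} (hα : StrictMono α) (T : CBTree n)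
    {a b : ℕ} (hab : a ≤ b) (hb : b ≤ n) :
    initialSum α (b - a) ≤ intervalSum a b (lodayVertex α T) ∧
    (a < b → (intervalSum a b (lodayVertex α T) = initialSum α (b - a) ↔
      IsBracket [T.1.1] 0 a b)) := by
  have hl := T.1.2.2
  have h := (sum_treeVal_subtreeAt hα T.isBinary (by omega) 0).2 a b (Nat.zero_le a) hab (by omega)
  have e : intervalSum a b (lodayVertex α T) =
      ∑ i ∈ Finset.Ico a b, treeVal α (T.1.1.subtreeAt (i - 0)) := by
    rw [intervalSum_apply]
    refine Finset.sum_congr rfl fun i hi => ?_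
    rw [Finset.mem_Ico] at hi
    simp [extendZero, lodayVertex, show i < n by omega]
  rwa [← e] at h

theorem lodayVertex_mem {n : ℕ} (α : Fin n → ℝ) (T : CBTree n) : lodayVertex α T ∈ LodAsso α :=
  subset_convexHull ℝ _ ⟨T, rfl⟩

theorem le_intervalSum_of_mem {n : ℕ} {α : Fin n → ℝ} (hα : StrictMono α) {x : Fin n → ℝ}
    (hx : x ∈ LodAsso α) {a b : ℕ} (hab : a ≤ b) (hb : b ≤ n) :
    initialSum α (b - a) ≤ intervalSum a b x := by
  have : LodAsso α ⊆ {x | initialSum α (b - a) ≤ intervalSum a b x} := by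
    refine convexHull_min ?_ (convex_halfSpace_ge (intervalSum a b).isLinear _)
    rintro _ ⟨T, rfl⟩
    exact (intervalSum_lodayVertex hα T hab hb).1
  exact this hx

theorem intervalSum_full_of_mem {n : ℕ} {α : Fin n → ℝ} (hα : StrictMono α) (hn : 1 ≤ n)
    {x : Fin n → ℝ} (hx : x ∈ LodAsso α) : intervalSum 0 n x = initialSum α n := by
  have : LodAsso α ⊆ {x | intervalSum 0 n x = initialSum α n} := by
    refine convexHull_min ?_ (convex_hyperplane (intervalSum 0 n).isLinear _)
    rintro _ ⟨T, rfl⟩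
    exact ((intervalSum_lodayVertex hα T (Nat.zero_le n) le_rfl).2 hn).mpr
      (T.1.bracket_full hn)
  exact this hx

/-! ### Maximizing linear functionals -/

/-- Brackets of a weight vector, regarded as an interval without constraints at its ends. -/
def VectorBracket {n : ℕ} (w : Fin n → ℝ) (a b : ℕ) : Prop :=
  ∃ W, (∀ i, w i < W) ∧ WeightBracket (extendZero w) W 0 n a b

theorem exists_forall_lt {n : ℕ} (w : Fin n → ℝ) : ∃ W, ∀ i, w i < W := by
  obtain ⟨M, hM⟩ := (Set.finite_range w).bddAbove
  exact ⟨M + 1, fun i => by linarith [hM ⟨i, rfl⟩]⟩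

theorem extendZero_lt {n : ℕ} {w : Fin n → ℝ} {W : ℝ} (hW : ∀ i, w i < W) {i : ℕ} (hi : i < n) :
    extendZero w i < W := by
  simpa [extendZero, hi] using hW ⟨i, hi⟩

theorem vectorBracket_iff {n : ℕ} {w : Fin n → ℝ} {W : ℝ} (hW : ∀ i, w i < W) (a b : ℕ) :
    VectorBracket w a b ↔ WeightBracket (extendZero w) W 0 n a b :=
  ⟨fun ⟨_, _, h⟩ => h.of_monotone (fun _ hi => extendZero_lt hW hi) fun _ _ _ _ h => h,
    fun h => ⟨W, hW, h⟩⟩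

theorem VectorBracket.bounds {n : ℕ} {w : Fin n → ℝ} {a b : ℕ} (h : VectorBracket w a b) :
    a < b ∧ b ≤ n := by
  obtain ⟨_, _, h⟩ := h
  exact ⟨h.2.1, h.2.2.1⟩

theorem VectorBracket.of_monotone {n : ℕ} {w w' : Fin n → ℝ} (h : ∀ i j, w i ≤ w j → w' i ≤ w' j)
    {a b : ℕ} (hb : VectorBracket w' a b) : VectorBracket w a b := by
  obtain ⟨W, hW⟩ := exists_forall_lt w
  obtain ⟨W', hW', hb⟩ := hb
  refine ⟨W, hW, hb.of_monotone (fun _ hi => extendZero_lt hW hi) fun i hi j hj hij => ?_⟩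
  simp only [extendZero, hi, hj, dif_pos] at hij ⊢
  exact lt_of_not_ge fun hle => absurd (h _ _ hle) (not_le.mpr hij)

/-- Since `z` has total sum `0`, the cap `W` drops out of `sum_weight_le`. -/
theorem dotProduct_le_of_intervalSum {n : ℕ} {w z : Fin n → ℝ} (h0 : intervalSum 0 n z = 0)
    (hz : ∀ a b, VectorBracket w a b → 0 ≤ intervalSum a b z) :
    w ⬝ᵥ z ≤ 0 ∧ (w ⬝ᵥ z = 0 → ∀ a b, VectorBracket w a b → intervalSum a b z = 0) := by
  obtain ⟨W, hW⟩ := exists_forall_lt w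
  have h := sum_weight_le (extendZero w) (extendZero z) 0 n W (Nat.zero_le n)
    (fun i _ hi => (extendZero_lt hW hi).le)
    fun a b hb => hz a b ((vectorBracket_iff hW a b).mpr hb)
  rw [intervalSum_apply] at h0
  rw [← dotProduct_eq_sum_Ico, h0, mul_zero] at h
  exact ⟨h.1, fun h1 a b hb => h.2 h1 a b ((vectorBracket_iff hW a b).mp hb)⟩

/-- The points of the Loday associahedron on the supporting hyperplanes of all given intervals. -/
def tightSet {n : ℕ} (α : Fin n → ℝ) (B : ℕ → ℕ → Prop) : Set (Fin n → ℝ) :=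
  {x ∈ LodAsso α | ∀ a b, B a b → intervalSum a b x = initialSum α (b - a)}

/-- The difference `z = x - y` has total sum `0` and nonnegative bracket sums, because `y` attains
the lower bounds that `x` satisfies. -/
theorem dotProduct_le_of_mem_tightSet {n : ℕ} {α : Fin n → ℝ} (hα : StrictMono α) (hn : 1 ≤ n)
    {w x y : Fin n → ℝ} (hx : x ∈ LodAsso α) (hy : y ∈ tightSet α (VectorBracket w)) :
    w ⬝ᵥ x ≤ w ⬝ᵥ y ∧ (w ⬝ᵥ x = w ⬝ᵥ y → x ∈ tightSet α (VectorBracket w)) := by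
  have h := dotProduct_le_of_intervalSum (w := w) (z := x - y)
    (by rw [map_sub, intervalSum_full_of_mem hα hn hx, intervalSum_full_of_mem hα hn hy.1, sub_self])
    (fun a b hb => by
      have := hb.bounds
      rw [map_sub, hy.2 a b hb, sub_nonneg]
      exact le_intervalSum_of_mem hα hx this.1.le this.2)
  rw [dotProduct_sub, sub_nonpos, sub_eq_zero] at h
  refine ⟨h.1, fun he => ⟨hx, fun a b hb => ?_⟩⟩
  have := h.2 he a b hb
  rwa [map_sub, hy.2 a b hb, sub_eq_zero] at this

theorem SBTree.exists_of_vector {n : ℕ} (w : Fin n → ℝ) :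
    ∃ T : SBTree n, ∀ a b, IsBracket [T.1] 0 a b ↔ VectorBracket w a b := by
  obtain ⟨W, hW⟩ := exists_forall_lt w
  obtain ⟨T, h1, h2, h3, -⟩ := exists_tree_of_weight (n := n) fun i hi => extendZero_lt hW hi
  exact ⟨⟨T, h1, h2⟩, fun a b => by rw [h3, vectorBracket_iff hW]⟩

theorem SBTree.exists_vector {n : ℕ} (hn : 1 ≤ n) (T : SBTree n) :
    ∃ w : Fin n → ℝ, ∀ a b, IsBracket [T.1] 0 a b ↔ VectorBracket w a b := by
  obtain ⟨w, hw, hb⟩ := exists_weight_of_tree T.2.1 hn T.2.2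
  have hW : ∀ i : Fin n, w i.val < 0 := fun i => hw i i.2
  refine ⟨fun i => w i.val, fun a b => ?_⟩
  rw [hb, vectorBracket_iff hW]
  have e : ∀ i < n, extendZero (fun i : Fin n => w i.val) i = w i := fun i hi => by
    simp [extendZero, hi]
  constructor <;> intro h
  · refine h.of_monotone (fun i hi => by rw [e i hi]; exact hw i hi) fun i hi j hj => ?_
    rw [e i hi, e j hj]; exact id
  · refine h.of_monotone hw fun i hi j hj => ?_
    rw [e i hi, e j hj]; exact id

theorem SBTree.exists_binary_avoiding {n : ℕ} (hn : 1 ≤ n) (T : SBTree n) {a b : ℕ}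
    (hab : a < b) (hbn : b ≤ n) (h : ¬ IsBracket [T.1] 0 a b) :
    ∃ U : CBTree n, U.1 ≤ T ∧ ¬ IsBracket [U.1.1] 0 a b := by
  obtain ⟨U, h1, h2, h3, h4⟩ := _root_.exists_binary_avoiding T.2.1 hn T.2.2 hab hbn h
  obtain ⟨V, rfl⟩ := CBTree.exists_eq h1 h2
  exact ⟨V, (SBTree.le_iff hn).mpr h3, h4⟩

theorem SBTree.exists_binary_le {n : ℕ} (hn : 1 ≤ n) (T : SBTree n) : ∃ U : CBTree n, U.1 ≤ T := by
  obtain ⟨w, hw0, hw⟩ := exists_weight_of_tree T.2.1 hn T.2.2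
  -- Any tie-breaking will do; the pair `0, 1` merely supplies the preference that the lemma asks
  -- for.
  obtain ⟨w', hinj, hmono, -⟩ := exists_injOn_weight w n
    (if w 0 ≤ w 1 then 1 else 0) (if w 0 ≤ w 1 then 0 else 1) (by split_ifs <;> linarith)
    (by split_ifs <;> simp)
  obtain ⟨W, hW⟩ := exists_forall_lt fun i : Fin n => w' i.val
  obtain ⟨U, -, hU, hUb, hbin⟩ := exists_tree_of_weight (w := w') fun i hi => hW ⟨i, hi⟩
  obtain ⟨V, rfl⟩ := CBTree.exists_eq (hbin hinj) hU
  refine ⟨V, (SBTree.le_iff hn).mpr fun a b hb => ?_⟩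
  rw [hUb]
  exact ((hw a b).mp hb).of_monotone (fun i hi => hW ⟨i, hi⟩) hmono

/-! ### Faces -/

/-- The face of the Loday associahedron that belongs to a tree. -/
def treeFace {n : ℕ} (α : Fin n → ℝ) (T : SBTree n) : Set (Fin n → ℝ) :=
  tightSet α (IsBracket [T.1] 0)

theorem lodayVertex_mem_treeFace {n : ℕ} {α : Fin n → ℝ} (hα : StrictMono α) (hn : 1 ≤ n)
    {U : CBTree n} {T : SBTree n} : lodayVertex α U ∈ treeFace α T ↔ U.1 ≤ T := by
  rw [SBTree.le_iff hn]
  refine ⟨fun h a b hb => ?_, fun h => ⟨lodayVertex_mem α U, fun a b hb => ?_⟩⟩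
  · have h1 := T.bracket_bounds hb
    exact ((intervalSum_lodayVertex hα U h1.1.le h1.2).2 h1.1).mp (h.2 a b hb)
  · have h1 := T.bracket_bounds hb
    exact ((intervalSum_lodayVertex hα U h1.1.le h1.2).2 h1.1).mpr (h a b hb)

theorem treeFace_nonempty {n : ℕ} {α : Fin n → ℝ} (hα : StrictMono α) (hn : 1 ≤ n)
    (T : SBTree n) : (treeFace α T).Nonempty := by
  obtain ⟨U, hU⟩ := T.exists_binary_le hn
  exact ⟨_, (lodayVertex_mem_treeFace hα hn).mpr hU⟩

/-- If `S` had a bracket that `T` lacks, a binary refinement of `T` avoiding it would give a vertex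
in the face of `T` but not in that of `S`. -/
theorem treeFace_subset_iff {n : ℕ} {α : Fin n → ℝ} (hα : StrictMono α) (hn : 1 ≤ n)
    {T S : SBTree n} : treeFace α T ⊆ treeFace α S ↔ T ≤ S := by
  constructor
  · intro h
    rw [SBTree.le_iff hn]
    intro a b hS
    by_contra hT
    have h1 := S.bracket_bounds hS
    obtain ⟨U, hU, hU'⟩ := T.exists_binary_avoiding hn h1.1 h1.2 hT
    have := (lodayVertex_mem_treeFace hα hn).mp (h ((lodayVertex_mem_treeFace hα hn).mpr hU))
    exact hU' ((SBTree.le_iff hn).mp this a b hS)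
  · rintro h x ⟨h1, h2⟩
    exact ⟨h1, fun a b hb => h2 a b ((SBTree.le_iff hn).mp h a b hb)⟩

/-- Points tight at the brackets of `w` are maximal. Conversely, such a point exists, and a
maximizer has the same value of `w`, so the equality case makes it tight as well. -/
theorem treeFace_eq_maximizers {n : ℕ} {α : Fin n → ℝ} (hα : StrictMono α) (hn : 1 ≤ n)
    {T : SBTree n} {w : Fin n → ℝ} (h : ∀ a b, IsBracket [T.1] 0 a b ↔ VectorBracket w a b) :
    treeFace α T = {x ∈ LodAsso α | ∀ y ∈ LodAsso α, w ⬝ᵥ y ≤ w ⬝ᵥ x} := by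
  have e : treeFace α T = tightSet α (VectorBracket w) := by
    unfold treeFace
    congr 1
    ext a b
    exact h a b
  ext x
  constructor
  · intro hx
    refine ⟨hx.1, fun y hy => ?_⟩
    rw [e] at hx
    exact (dotProduct_le_of_mem_tightSet hα hn hy hx).1
  · rintro ⟨hx, hmax⟩
    obtain ⟨y, hy⟩ := treeFace_nonempty hα hn T
    have := hmax y hy.1
    rw [e] at hy ⊢
    have h2 := dotProduct_le_of_mem_tightSet hα hn hx hy
    exact h2.2 (le_antisymm h2.1 this)

theorem exists_dual_eq_dotProduct {n : ℕ} (w : Fin n → ℝ) :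
    ∃ l : StrongDual ℝ (Fin n → ℝ), ∀ x, l x = w ⬝ᵥ x :=
  ⟨∑ i, w i • ContinuousLinearMap.proj i, fun x => by simp [dotProduct]⟩

theorem exists_dotProduct_eq_linear {n : ℕ} (l : (Fin n → ℝ) →ₗ[ℝ] ℝ) :
    ∃ w : Fin n → ℝ, ∀ x, l x = w ⬝ᵥ x :=
  ⟨fun i => l (Pi.single i 1), fun x => by
    rw [LinearMap.pi_apply_eq_sum_univ l x]
    refine Finset.sum_congr rfl fun i _ => ?_
    rw [smul_eq_mul, mul_comm]
    congr 2
    ext j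
    simp [Pi.single_apply, eq_comm]⟩

theorem isExposed_maximizers {n : ℕ} (P : Set (Fin n → ℝ)) (w : Fin n → ℝ) :
    IsExposed ℝ P {x ∈ P | ∀ y ∈ P, w ⬝ᵥ y ≤ w ⬝ᵥ x} := by
  obtain ⟨l, hl⟩ := exists_dual_eq_dotProduct w
  exact fun _ => ⟨l, by simp [hl]⟩

theorem isExposed_treeFace {n : ℕ} {α : Fin n → ℝ} (hα : StrictMono α) (hn : 1 ≤ n)
    (T : SBTree n) : IsExposed ℝ (LodAsso α) (treeFace α T) := by
  obtain ⟨w, hw⟩ := T.exists_vector hn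
  rw [treeFace_eq_maximizers hα hn hw]
  exact isExposed_maximizers _ _

theorem exists_eq_treeFace {n : ℕ} {α : Fin n → ℝ} (hα : StrictMono α) (hn : 1 ≤ n)
    {F : Set (Fin n → ℝ)} (hF : IsExposed ℝ (LodAsso α) F) (hne : F.Nonempty) :
    ∃ T : SBTree n, F = treeFace α T := by
  obtain ⟨l, rfl⟩ := hF hne
  obtain ⟨w, hw⟩ := exists_dotProduct_eq_linear l.toLinearMap
  have hw : ∀ x, l x = w ⬝ᵥ x := hw
  obtain ⟨T, hT⟩ := SBTree.exists_of_vector w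
  exact ⟨T, by rw [treeFace_eq_maximizers hα hn hT]; simp only [hw]⟩

/-- The face poset of the Loday associahedron. -/
theorem nonempty_facePoset_orderIso {d : ℕ} {α : Fin (d + 1) → ℝ} (hα : StrictMono α) :
    Nonempty (FacePoset (LodAsso α) ≃o AssoPoset d) := by
  have hn : 1 ≤ d + 1 := by omega
  let f : AssoPoset d → FacePoset (LodAsso α) := fun T => match T with
    | ⊥ => ⟨∅, fun h => absurd h Set.not_nonempty_empty⟩
    | (T : SBTree (d + 1)) => ⟨treeFace α T, isExposed_treeFace hα hn T⟩
  have hle : ∀ {T S}, f T ≤ f S ↔ T ≤ S := by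
    intro T S
    induction T using WithBot.recBotCoe with
    | bot => exact iff_of_true (Set.empty_subset _) bot_le
    | coe T =>
      induction S using WithBot.recBotCoe with
      | bot =>
        refine iff_of_false (fun h => ?_) (by simp)
        obtain ⟨x, hx⟩ := treeFace_nonempty hα hn T
        exact h hx
      | coe S => rw [WithBot.coe_le_coe]; exact treeFace_subset_iff hα hn
  have hsurj : Function.Surjective f := by
    rintro ⟨F, hF⟩
    rcases F.eq_empty_or_nonempty with rfl | hne
    · exact ⟨⊥, rfl⟩
    · obtain ⟨T, rfl⟩ := exists_eq_treeFace hα hn hF hne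
      exact ⟨(T : SBTree (d + 1)), rfl⟩
  exact ⟨(RelIso.ofSurjective (OrderEmbedding.ofMapLEIff f fun _ _ => hle) hsurj).symm⟩

/-! ### Vertices and edges -/

theorem CBTree.eq_of_le {n : ℕ} {T U : CBTree n} (h : T.1 ≤ U.1) : T = U := by
  rcases ContractsTo.eq_or_lt h with h | h
  · exact Subtype.ext (Subtype.ext h)
  · rw [T.2, U.2] at h; omega

theorem lodayVertex_injective {n : ℕ} {α : Fin n → ℝ} (hα : StrictMono α) (hn : 1 ≤ n) :
    Function.Injective (lodayVertex α) := by
  intro T U h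
  refine CBTree.eq_of_le ((lodayVertex_mem_treeFace hα hn).mp ?_)
  rw [h]
  exact (lodayVertex_mem_treeFace hα hn).mpr le_rfl

theorem SBTree.finite (n : ℕ) (hn : 1 ≤ n) : Finite (SBTree n) := by
  refine Finite.of_injective (β := Set (Fin (n + 1) × Fin (n + 1)))
    (fun T => {q | IsBracket [T.1] 0 q.1 q.2}) fun T S h => ?_
  have key : ∀ {T S : SBTree n}, {q : Fin (n + 1) × Fin (n + 1) | IsBracket [T.1] 0 q.1 q.2} =
      {q | IsBracket [S.1] 0 q.1 q.2} → T ≤ S := by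
    intro T S h
    refine (SBTree.le_iff hn).mpr fun a b hb => ?_
    have h1 := S.bracket_bounds hb
    have h2 := Set.ext_iff.mp h (⟨a, by omega⟩, ⟨b, by omega⟩)
    exact h2.mpr hb
  exact le_antisymm (key h) (key h.symm)

theorem finite_range_lodayVertex {n : ℕ} (hn : 1 ≤ n) (α : Fin n → ℝ) :
    (Set.range (lodayVertex α)).Finite := by
  have := SBTree.finite n hn
  have : Finite (CBTree n) := Subtype.finite
  exact Set.finite_range _

/-- A face of a convex hull is the convex hull of the points that it contains. -/
theorem mem_convexHull_of_minimal {E : Type*} [AddCommGroup E] [Module ℝ E] {s : Set E}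
    (g : E →ₗ[ℝ] ℝ) {c : ℝ} (h : ∀ x ∈ s, c ≤ g x) {x : E} (hx : x ∈ convexHull ℝ s)
    (hc : g x = c) : x ∈ convexHull ℝ {y ∈ s | g y = c} := by
  have hsub : convexHull ℝ s ⊆ {x | c ≤ g x ∧ (g x = c → x ∈ convexHull ℝ {y ∈ s | g y = c})} := by
    refine convexHull_min (fun y hy => ⟨h y hy, fun hc => subset_convexHull ℝ _ ⟨hy, hc⟩⟩) ?_
    rintro y ⟨hy1, hy2⟩ z ⟨hz1, hz2⟩ a b ha hb hab
    have e : g (a • y + b • z) = a * g y + b * g z := by simp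
    have h1 := mul_le_mul_of_nonneg_left hy1 ha
    have h2 := mul_le_mul_of_nonneg_left hz1 hb
    have h3 : a * c + b * c = c := by rw [← add_mul, hab, one_mul]
    refine ⟨by rw [e]; linarith, fun hc => ?_⟩
    rw [e] at hc
    rcases ha.eq_or_lt with rfl | ha'
    · obtain rfl : b = 1 := by linarith
      simpa using hz2 (by linarith)
    rcases hb.eq_or_lt with rfl | hb'
    · obtain rfl : a = 1 := by linarith
      simpa using hy2 (by linarith)
    refine convex_convexHull ℝ _ (hy2 ?_) (hz2 ?_) ha hb hab
    · exact mul_left_cancel₀ ha'.ne' (by linarith)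
    · exact mul_left_cancel₀ hb'.ne' (by linarith)
  exact (hsub hx).2 hc

theorem treeFace_eq_convexHull {n : ℕ} {α : Fin n → ℝ} (hα : StrictMono α) (hn : 1 ≤ n)
    (T : SBTree n) : treeFace α T = convexHull ℝ (lodayVertex α '' {U | U.1 ≤ T}) := by
  obtain ⟨w, hw⟩ := T.exists_vector hn
  obtain ⟨l, hl⟩ := exists_dual_eq_dotProduct w
  have hF := treeFace_eq_maximizers hα hn hw
  refine Set.Subset.antisymm (fun x hx => ?_) (convexHull_min ?_ ?_)
  · have hx' := hx
    rw [hF] at hx'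
    -- The face maximizes `w`, hence the sign change.
    have := mem_convexHull_of_minimal (-l.toLinearMap) (c := -(w ⬝ᵥ x))
      (s := Set.range (lodayVertex α)) ?_ hx'.1 (by simp [hl])
    · refine convexHull_mono ?_ this
      rintro _ ⟨⟨U, rfl⟩, hU⟩
      refine ⟨U, (lodayVertex_mem_treeFace hα hn).mp ?_, rfl⟩
      rw [hF]
      refine ⟨lodayVertex_mem α U, fun y hy => ?_⟩
      simp [hl] at hU
      rw [hU]
      exact hx'.2 y hy
    · rintro _ ⟨U, rfl⟩
      simpa [hl] using hx'.2 _ (lodayVertex_mem α U)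
  · rintro _ ⟨U, hU, rfl⟩
    exact (lodayVertex_mem_treeFace hα hn).mpr hU
  · have hconv : Convex ℝ (LodAsso α) := convex_convexHull ℝ _
    exact (isExposed_treeFace hα hn T).convex hconv

theorem treeFace_binary {n : ℕ} {α : Fin n → ℝ} (hα : StrictMono α) (hn : 1 ≤ n)
    (T : CBTree n) : treeFace α T.1 = {lodayVertex α T} := by
  rw [treeFace_eq_convexHull hα hn]
  have : {U : CBTree n | U.1 ≤ T.1} = {T} := by
    ext U
    exact ⟨fun h => CBTree.eq_of_le h, fun h => (congrArg Subtype.val (Set.mem_singleton_iff.mp h)).le⟩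
  rw [this, Set.image_singleton, convexHull_singleton]

theorem exposedPoints_lodAsso {n : ℕ} {α : Fin n → ℝ} (hα : StrictMono α) (hn : 1 ≤ n) :
    (LodAsso α).exposedPoints ℝ = Set.range (lodayVertex α) := by
  ext x
  rw [mem_exposedPoints_iff_exposed_singleton]
  constructor
  · intro h
    obtain ⟨T, hT⟩ := exists_eq_treeFace hα hn h (Set.singleton_nonempty x)
    obtain ⟨U, hU⟩ := T.exists_binary_le hn
    have := (lodayVertex_mem_treeFace hα hn).mpr hU
    rw [← hT] at this
    exact ⟨U, this⟩
  · rintro ⟨T, rfl⟩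
    rw [← treeFace_binary hα hn]
    exact isExposed_treeFace hα hn T.1

/-- The segment is an edge exactly when `T` and `T'` are the only binary trees below some `S`. One
contraction of `T` has exactly two binary trees below it, namely `T` and a flip of `T`. -/
theorem isExposed_segment_iff_flip {n : ℕ} {α : Fin n → ℝ} (hα : StrictMono α) (hn : 1 ≤ n)
    {T T' : CBTree n} (hne : T ≠ T') :
    IsExposed ℝ (LodAsso α) (segment ℝ (lodayVertex α T) (lodayVertex α T')) ↔ T.Flip T' := by
  constructor
  · intro h
    obtain ⟨S, hS⟩ := exists_eq_treeFace hα hn h ⟨_, left_mem_segment ℝ _ _⟩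
    have only : ∀ U : CBTree n, U.1 ≤ S → U = T ∨ U = T' := by
      intro U hU
      have h1 := (lodayVertex_mem_treeFace hα hn).mpr hU
      rw [← hS, ← insert_endpoints_openSegment] at h1
      have hinj := lodayVertex_injective hα hn
      rcases h1 with h1 | h1 | h1
      · exact Or.inl (hinj h1)
      · exact Or.inr (hinj h1)
      · have h2 : lodayVertex α U ∈ (LodAsso α).extremePoints ℝ := by
          refine exposedPoints_subset_extremePoints ?_
          rw [exposedPoints_lodAsso hα hn]
          exact ⟨U, rfl⟩
        have := (mem_extremePoints_iff_left.mp h2).2 _ (lodayVertex_mem α T) _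
          (lodayVertex_mem α T') h1
        exact Or.inl (hinj this.symm)
    have hT : T.1 ≤ S := (lodayVertex_mem_treeFace hα hn).mp (hS ▸ left_mem_segment ℝ _ _)
    have hT' : T'.1 ≤ S := (lodayVertex_mem_treeFace hα hn).mp (hS ▸ right_mem_segment ℝ _ _)
    rcases Relation.ReflTransGen.cases_head (show T.1.1.ContractsTo S.1 from hT) with
      hTS | ⟨S', ⟨j, hj⟩, hS'⟩
    · have hTS : T.1 = S := Subtype.ext hTS
      rw [← hTS] at hT'
      exact absurd (CBTree.eq_of_le hT').symm hne
    · obtain ⟨V, hV, hVT, hflip, -⟩ := ContractsEdge.exists_flip T.isBinary hj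
      have hVe : ∃ k, ContractsEdge k V S' := by
        rcases hflip with h | h
        · exact ⟨_, h.2⟩
        · exact ⟨_, h.2⟩
      obtain ⟨k, hk⟩ := hVe
      have hVl : V.numLeaves = n + 1 := by
        rw [hk.leaves_and_brackets.1, ← hj.leaves_and_brackets.1, T.1.2.2]
      obtain ⟨V, rfl⟩ := CBTree.exists_eq hV hVl
      have hVS : V.1 ≤ S := Relation.ReflTransGen.head ⟨k, hk⟩ hS'
      rcases only V hVS with rfl | rfl
      · exact absurd rfl hVT
      · exact ⟨S', hflip⟩
  · rintro ⟨S, hS⟩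
    obtain ⟨j, k, hj, hk⟩ : ∃ j k, ContractsEdge j T.1.1 S ∧ ContractsEdge k T'.1.1 S := by
      rcases hS with h | h
      · exact ⟨_, _, h⟩
      · exact ⟨_, _, h⟩
    obtain ⟨S, rfl⟩ := SBTree.exists_eq (n := n) (hj.strictlyBranching T.1.2.1)
      (hj.leaves_and_brackets.1 ▸ T.1.2.2)
    obtain ⟨V, hV, hVT, -, huniq⟩ := ContractsEdge.exists_flip T.isBinary hj
    have hT'V : T'.1.1 = V := (huniq k _ T'.isBinary hk).resolve_left
      fun h => hne (Subtype.ext (Subtype.ext h.symm))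
    have hset : {U : CBTree n | U.1 ≤ S} = {T, T'} := by
      ext U
      constructor
      · intro hU
        obtain ⟨m, hm⟩ := ContractsTo.edge_of_isBinary U.isBinary T.isBinary hj hU
        rcases huniq m _ U.isBinary hm with h | h
        · exact Or.inl (Subtype.ext (Subtype.ext h))
        · exact Or.inr (Subtype.ext (Subtype.ext (h.trans hT'V.symm)))
      · rintro (rfl | rfl)
        · exact Relation.ReflTransGen.single ⟨j, hj⟩
        · exact Relation.ReflTransGen.single ⟨k, hk⟩
    rw [← convexHull_pair, ← Set.image_pair, ← hset, ← treeFace_eq_convexHull hα hn]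
    exact isExposed_treeFace hα hn S

/-! ### Dimension -/

/-- The face maximizing such a `w` is the whole polytope, so its brackets occur in every binary
tree, and only the full interval does. Then every `z` with total sum `0` satisfies `w ⬝ᵥ z ≤ 0`, in
particular differences of unit vectors. -/
theorem eq_of_dotProduct_const {n : ℕ} {α : Fin n → ℝ} (hα : StrictMono α) (hn : 1 ≤ n)
    {w : Fin n → ℝ} (hw : ∀ x ∈ LodAsso α, ∀ y ∈ LodAsso α, w ⬝ᵥ x = w ⬝ᵥ y) (i j : Fin n) :
    w i = w j := by
  obtain ⟨T, hT⟩ := SBTree.exists_of_vector w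
  have hall : ∀ U : CBTree n, U.1 ≤ T := fun U => by
    rw [← lodayVertex_mem_treeFace hα hn, treeFace_eq_maximizers hα hn hT]
    exact ⟨lodayVertex_mem α U, fun y hy => (hw _ hy _ (lodayVertex_mem α U)).le⟩
  -- The zero weight gives the corolla, whose only bracket is the full interval; any other interval
  -- is avoided by some binary tree.
  obtain ⟨C, hC⟩ := SBTree.exists_of_vector (0 : Fin n → ℝ)
  have hfull : ∀ a b, VectorBracket w a b → a = 0 ∧ b = n := by
    intro a b hb
    have h1 := hb.bounds
    have hCb : IsBracket [C.1] 0 a b := by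
      by_contra h
      obtain ⟨U, -, hU⟩ := C.exists_binary_avoiding hn h1.1 h1.2 h
      exact hU ((SBTree.le_iff hn).mp (hall U) a b ((hT a b).mpr hb))
    obtain ⟨W, hW, -, -, -, h⟩ := (hC a b).mp hCb
    obtain ⟨-, g2, -, g4⟩ := h a le_rfl h1.1
    have e : ∀ i, extendZero (0 : Fin n → ℝ) i = 0 := fun i => by simp [extendZero]
    simp only [e, lt_irrefl, imp_false] at g2 g4
    refine ⟨?_, by omega⟩
    by_contra ha
    exact g2 (a - 1) (Nat.zero_le _) (by omega)
  have key : ∀ i j : Fin n, w i ≤ w j := by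
    intro i j
    have h0 : intervalSum 0 n (Pi.single i 1 - Pi.single j 1 : Fin n → ℝ) = 0 := by
      rw [intervalSum_full]; simp
    have h := (dotProduct_le_of_intervalSum (w := w) h0 fun a b hb => by
      obtain ⟨rfl, rfl⟩ := hfull a b hb
      exact h0.ge).1
    rw [dotProduct_sub] at h
    simpa using h
  exact le_antisymm (key i j) (key j i)

theorem finrank_vectorSpan_lodAsso {d : ℕ} {α : Fin (d + 1) → ℝ} (hα : StrictMono α) :
    Module.finrank ℝ (vectorSpan ℝ (LodAsso α)) = d := by
  have hn : 1 ≤ d + 1 := by omega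
  set V := vectorSpan ℝ (LodAsso α) with hV
  -- The functionals constant on the polytope are the multiples of the coordinate sum, so the
  -- direction space has codimension one.
  have hann : V.dualAnnihilator = Submodule.span ℝ {intervalSum 0 (d + 1)} := by
    ext φ
    rw [Submodule.mem_span_singleton, Submodule.mem_dualAnnihilator]
    constructor
    · intro h
      obtain ⟨w, hw⟩ := exists_dotProduct_eq_linear φ
      have hc := eq_of_dotProduct_const hα hn (w := w) fun x hx y hy => by
        have := h _ (vsub_mem_vectorSpan ℝ hx hy)
        rw [vsub_eq_sub, map_sub, hw, hw] at this
        linarith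
      refine ⟨w 0, ?_⟩
      refine LinearMap.ext fun x => ?_
      rw [hw, LinearMap.smul_apply, intervalSum_full, smul_eq_mul, Finset.mul_sum, dotProduct]
      exact Finset.sum_congr rfl fun i _ => by rw [hc i 0]
    · rintro ⟨c, rfl⟩ v hv
      have : V ≤ LinearMap.ker (intervalSum 0 (d + 1) : (Fin (d + 1) → ℝ) →ₗ[ℝ] ℝ) := by
        rw [hV, vectorSpan_def, Submodule.span_le]
        rintro _ ⟨x, hx, y, hy, rfl⟩
        simp [intervalSum_full_of_mem hα hn hx, intervalSum_full_of_mem hα hn hy]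
      simp [LinearMap.mem_ker.mp (this hv)]
  have h1 := Subspace.finrank_add_finrank_dualAnnihilator_eq V
  have hne : (intervalSum 0 (d + 1) : (Fin (d + 1) → ℝ) →ₗ[ℝ] ℝ) ≠ 0 := by
    intro h
    have := congrArg (fun φ => φ (Pi.single 0 1)) h
    simp [intervalSum_full] at this
  rw [hann, finrank_span_singleton hne, Module.finrank_fin_fun] at h1
  omega

theorem isAssociahedron_lodAsso {d : ℕ} {α : Fin (d + 1) → ℝ} (hα : StrictMono α) :
    IsAssociahedron d (LodAsso α) := by
  have hn : 1 ≤ d + 1 := by omega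
  have hE := exposedPoints_lodAsso hα hn
  refine ⟨⟨_, finite_range_lodayVertex hn α, rfl⟩, finrank_vectorSpan_lodAsso hα, ?_⟩
  refine ⟨(Equiv.ofInjective _ (lodayVertex_injective hα hn)).trans (Equiv.setCongr hE.symm), ?_⟩
  intro T T' hne
  exact isExposed_segment_iff_flip hα hn hne

/-! ### Generalized permutohedra -/

/-- A weight in the normal cone of the face of the usual permutohedron that maximizes `w` is weakly
monotone in `w`. -/
theorem monotone_of_permutohedron {n : ℕ} {β w w' : Fin n → ℝ} (hβ : StrictMono β)
    (h : ∀ x ∈ Permutohedron β, (∀ y ∈ Permutohedron β, w ⬝ᵥ y ≤ w ⬝ᵥ x) →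
      ∀ y ∈ Permutohedron β, w' ⬝ᵥ y ≤ w' ⬝ᵥ x) (i j : Fin n) (hij : w i ≤ w j) :
    w' i ≤ w' j := by
  let pt : Equiv.Perm (Fin n) → Fin n → ℝ := fun π k => β (π k)
  have hmem : ∀ π, pt π ∈ Permutohedron β := fun π => subset_convexHull ℝ _ ⟨π, rfl⟩
  have hmax : ∀ π, (∀ σ, w ⬝ᵥ pt σ ≤ w ⬝ᵥ pt π) → ∀ y ∈ Permutohedron β, w ⬝ᵥ y ≤ w ⬝ᵥ pt π := by
    intro π hπ
    obtain ⟨l, hl⟩ := exists_dual_eq_dotProduct w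
    have : Permutohedron β ⊆ {y | l y ≤ w ⬝ᵥ pt π} := by
      refine convexHull_min ?_ (convex_halfSpace_le l.toLinearMap.isLinear _)
      rintro _ ⟨σ, rfl⟩
      simpa [hl] using hπ σ
    intro y hy
    simpa [hl] using this hy
  obtain ⟨π, -, hπ⟩ := Finset.exists_max_image Finset.univ (fun π => w ⬝ᵥ pt π)
    Finset.univ_nonempty
  have hπ : ∀ σ, w ⬝ᵥ pt σ ≤ w ⬝ᵥ pt π := fun σ => hπ σ (Finset.mem_univ σ)
  by_cases hne : i = j
  · rw [hne]
  -- Compare a maximizing vertex with the one obtained by exchanging its entries at `i` and `j`. If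
  -- `w i = w j`, both maximize `w` and hence `w'`; otherwise the larger entry sits at `j`.
  have swap_sub : ∀ u : Fin n → ℝ, u ⬝ᵥ pt π - u ⬝ᵥ pt (π * Equiv.swap i j) =
      (u j - u i) * (β (π j) - β (π i)) := by
    intro u
    have e : pt π - pt (π * Equiv.swap i j) =
        (β (π i) - β (π j)) • (Pi.single i 1 - Pi.single j 1 : Fin n → ℝ) := by
      ext k
      by_cases hki : k = i
      · subst hki; simp [pt, hne]
      · by_cases hkj : k = j
        · subst hkj; simp [pt, hki]
        · simp [pt, Equiv.swap_apply_of_ne_of_ne hki hkj, hki, hkj]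
    rw [← dotProduct_sub, e, dotProduct_smul, dotProduct_sub]
    simp
    ring
  have h1 := swap_sub w
  have h2 := swap_sub w'
  have h3 := hπ (π * Equiv.swap i j)
  have h4 := h _ (hmem π) (hmax π hπ) _ (hmem (π * Equiv.swap i j))
  have hβne : β (π i) ≠ β (π j) := fun he => hne (π.injective (hβ.injective he))
  rcases hij.eq_or_lt with heq | hlt
  · have h5 : w ⬝ᵥ pt (π * Equiv.swap i j) = w ⬝ᵥ pt π := by
      rw [heq, sub_self, zero_mul] at h1; linarith
    have h6 := h _ (hmem (π * Equiv.swap i j)) (hmax _ fun σ => h5 ▸ hπ σ) _ (hmem π)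
    have h7 : (w' j - w' i) * (β (π j) - β (π i)) = 0 := by linarith
    rcases mul_eq_zero.mp h7 with h | h
    · linarith
    · exact absurd (by linarith) hβne
  · have h5 : 0 < β (π j) - β (π i) := by
      rcases lt_or_gt_of_ne hβne with h | h
      · linarith
      · have : (w j - w i) * (β (π j) - β (π i)) < 0 :=
          mul_neg_of_pos_of_neg (by linarith) (by linarith)
        linarith
    by_contra! h6
    have : (w' j - w' i) * (β (π j) - β (π i)) < 0 := mul_neg_of_neg_of_pos (by linarith) h5
    linarith

theorem isDeformation_lodAsso {n : ℕ} {α : Fin n → ℝ} (hα : StrictMono α) (hn : 1 ≤ n) :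
    IsDeformation (LodAsso α) (Permutohedron α) := by
  rintro C ⟨F, hF, hne, rfl⟩
  -- It suffices that each `w` in the cone lies in a permutohedron cone contained in it: take the
  -- one of the face `G` maximizing `w`. Any `w'` there is weakly monotone in `w`, so its brackets
  -- are among those of `w`, and points of `F` are tight for them.
  refine ⟨{D ∈ normalFan (Permutohedron α) | D ⊆ normalCone F (LodAsso α)}, fun D hD => hD.1, ?_⟩
  refine Set.Subset.antisymm ?_ (Set.sUnion_subset fun D hD => hD.2)
  rintro _ ⟨w, hw, rfl⟩
  set G := {x ∈ Permutohedron α | ∀ y ∈ Permutohedron α, w ⬝ᵥ y ≤ w ⬝ᵥ x} with hG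
  have hGne : G.Nonempty := by
    obtain ⟨l, hl⟩ := exists_dual_eq_dotProduct w
    have hc : IsCompact (Permutohedron α) := (Set.finite_range _).isCompact_convexHull ℝ
    obtain ⟨x, hx, hmax⟩ := hc.exists_isMaxOn
      ⟨_, subset_convexHull ℝ _ ⟨(1 : Equiv.Perm (Fin n)), rfl⟩⟩ l.continuous.continuousOn
    exact ⟨x, hx, fun y hy => by rw [← hl, ← hl]; exact hmax hy⟩
  refine ⟨normalCone G (Permutohedron α), ⟨⟨G, isExposed_maximizers _ w, hGne, rfl⟩, ?_⟩, ?_⟩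
  · rintro _ ⟨w', hw', rfl⟩
    refine ⟨w', fun y hy y' hy' => ?_, rfl⟩
    have hmono := monotone_of_permutohedron hα fun x hx hmax => hw' x ⟨hx, hmax⟩
    obtain ⟨T, hT⟩ := SBTree.exists_of_vector w
    have hyP := hF.subset hy
    have hyT : y ∈ treeFace α T := by
      rw [treeFace_eq_maximizers hα hn hT]
      exact ⟨hyP, hw y hy⟩
    exact (dotProduct_le_of_mem_tightSet hα hn hy'
      ⟨hyP, fun a b hb => hyT.2 a b ((hT a b).mpr (hb.of_monotone hmono))⟩).1
  · exact ⟨w, fun y hy y' hy' => hy.2 y' hy', rfl⟩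

theorem isGeneralizedPermutohedron_lodAsso {n : ℕ} {α : Fin n → ℝ} (hα : StrictMono α)
    (hn : 1 ≤ n) : IsGeneralizedPermutohedron (LodAsso α) :=
  ⟨⟨_, finite_range_lodayVertex hn α, rfl⟩,
    ⟨initialSum α n, fun x hx => by rw [← intervalSum_full, intervalSum_full_of_mem hα hn hx]⟩,
    α, hα, isDeformation_lodAsso hα hn⟩

theorem theorem4p3 (d : ℕ) (α : Fin (d + 1) → ℝ) (hα : StrictMono α) :
    Nonempty (FacePoset (LodAsso α) ≃o AssoPoset d) ∧
      IsAssociahedron d (LodAsso α) ∧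
      IsGeneralizedPermutohedron (LodAsso α) :=
  ⟨nonempty_facePoset_orderIso hα, isAssociahedron_lodAsso hα,
    isGeneralizedPermutohedron_lodAsso hα (by omega)⟩
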